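/- A (directed) graph $E=(E^0,E^1,r,s)$ consists of countable sets $E^0$ of vertices and $E^1$ of edges and maps $r,s:E^1\to E^0$ (range and source). It is regular if $0<|s^{-1}(v)|<\infty$ for every $v\in E^0$. Its vertex matrix is $A_E(v,w)=\#\{e\in E^1: s(e)=v,\ r(e)=w\}$. The graph $C^*$-algebra $C^*(E)$ is the universal $C^*$-algebra generated by mutually orthogonal projections $\{p_v:v\in E^0\}$ and partial isometries $\{s_e:e\in E^1\}$ with mutually orthogonal range projections such that $s_e^*s_e=p_{r(e)}$ and $s_es_e^*\le p_{s(e)}$ for all $e\in E^1$, and $p_v=\sum_{s(e)=v}s_es_e^*$ whenever $0<|s^{-1}(v)|<\infty$. A non-negative integer matrix (with countable, possibly infinite, index sets) is regular if each of its rows has a finite and nonzero number of positive entries. Regular, square, non-negative integer matrices $A$ and $B$ (possibly of different sizes) are elementary strong shift equivalent if there are non-negative integer matrices $R$ and $S$ with $A=RS$ and $B=SR$ (all the sums in these products being finite). They are strong shift equivalent if there is a finite sequence $A=C_1,C_2,\dots,C_n=B$ of regular, square, non-negative integer matrices such that $C_i$ is elementary strong shift equivalent to $C_{i+1}$ for $1\le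 i<n$. **Theorem.** Let $E$ and $F$ be regular graphs. If the vertex matrices $A_E$ and $A_F$ are strong shift equivalent, then $C^*(E)$ and $C^*(F)$ are Morita equivalent, i.e. there is a $C^*(E)$–$C^*(F)$ imprimitivity bimodule. -/

import Mathlib

open scoped ENNReal

universe u

/-! ### Directed graphs and their vertex matrices -/

/-- A directed graph: countable sets of vertices and of edges, with source and range maps. -/
structure DirectedGraph where
  Vertex : Type u
  Edge : Type u
  source : Edge → Vertex
  range : Edge → Vertex
  countable_vertex : Countable Vertex
  countable_edge : Countable Edge

/-- A graph is regular if every vertex emits a finite and nonzero number of edges. -/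
def DirectedGraph.IsRegular (E : DirectedGraph.{u}) : Prop :=
  ∀ v : E.Vertex, {e : E.Edge | E.source e = v}.Finite ∧ {e : E.Edge | E.source e = v}.Nonempty

/-- The vertex matrix: the `(v, w)` entry is the number of edges from `v` to `w`. It is used only
for regular graphs, where all these numbers are finite. -/
noncomputable def DirectedGraph.vertexMatrix (E : DirectedGraph.{u}) :
    Matrix E.Vertex E.Vertex ℕ :=
  Matrix.of fun v w => {e : E.Edge | E.source e = v ∧ E.range e = w}.ncard

/-! ### Strong shift equivalence of regular matrices -/

/-- A (possibly infinite) non-negative integer matrix is regular if every row contains a finite and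
nonzero number of positive entries. -/
def Matrix.IsRegularNat {ι κ : Type*} (A : Matrix ι κ ℕ) : Prop :=
  ∀ i : ι, {j : κ | 0 < A i j}.Finite ∧ {j : κ | 0 < A i j}.Nonempty

/-- A regular, square, non-negative integer matrix, indexed by some countable set. -/
structure RegularSquareMatrix where
  Index : Type u
  countable_index : Countable Index
  entry : Matrix Index Index ℕ
  regular : entry.IsRegularNat

/-- `IsMatrixProduct R S A` says `A = R S` for possibly infinite matrices over `ℕ`: each of the
sums `∑ k, R i k * S k j` converges in the discrete space `ℕ` (so it has only finitely many nonzero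
terms) and its value is `A i j`. -/
def IsMatrixProduct {ι κ τ : Type*} (R : Matrix ι κ ℕ) (S : Matrix κ τ ℕ)
    (A : Matrix ι τ ℕ) : Prop :=
  ∀ i j, HasSum (fun k => R i k * S k j) (A i j)

/-- Elementary strong shift equivalence: `A = R S` and `B = S R`. -/
def ElementaryStrongShiftEquivalent (A B : RegularSquareMatrix.{u}) : Prop :=
  ∃ (R : Matrix A.Index B.Index ℕ) (S : Matrix B.Index A.Index ℕ),
    IsMatrixProduct R S A.entry ∧ IsMatrixProduct S R B.entry

/-- Strong shift equivalence: a finite chain `A = C₁, C₂, …, Cₙ = B` of regular square matrices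
in which consecutive ones are elementary strong shift equivalent. -/
def StrongShiftEquivalent (A B : RegularSquareMatrix.{u}) : Prop :=
  Relation.ReflTransGen ElementaryStrongShiftEquivalent A B

theorem DirectedGraph.IsRegular.isRegularNat_vertexMatrix {E : DirectedGraph.{u}}
    (hE : E.IsRegular) : E.vertexMatrix.IsRegularNat := by
  have key : ∀ v w, 0 < E.vertexMatrix v w ↔ ∃ e, E.source e = v ∧ E.range e = w := by
    intro v w
    have hfin : {e : E.Edge | E.source e = v ∧ E.range e = w}.Finite :=
      (hE v).1.subset fun e he => he.1
    exact Set.ncard_pos hfin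
  intro v
  constructor
  · refine ((hE v).1.image E.range).subset ?_
    intro w hw
    obtain ⟨e, he, hw⟩ := (key v w).1 hw
    exact ⟨e, he, hw⟩
  · obtain ⟨e, he⟩ := (hE v).2
    exact ⟨E.range e, (key v _).2 ⟨e, he, rfl⟩⟩

/-- The vertex matrix of a regular graph, as a regular square matrix. -/
noncomputable def DirectedGraph.regularVertexMatrix (E : DirectedGraph.{u}) (hE : E.IsRegular) :
    RegularSquareMatrix.{u} where
  Index := E.Vertex
  countable_index := E.countable_vertex
  entry := E.vertexMatrix
  regular := hE.isRegularNat_vertexMatrix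

/-! ### Cuntz–Krieger families and the graph algebra -/

/-- A Cuntz–Krieger `E`-family in a `*`-algebra `A`. For projections, `q ≤ p` means `p * q = q`. -/
structure CuntzKriegerFamily (E : DirectedGraph.{u}) (A : Type*) [NonUnitalRing A]
    [StarRing A] where
  p : E.Vertex → A
  s : E.Edge → A
  isStarProjection_p : ∀ v, IsStarProjection (p v)
  p_mul_p : ∀ v w, v ≠ w → p v * p w = 0
  isPartialIsometry_s : ∀ e, s e * star (s e) * s e = s e
  range_mul_range : ∀ e f, e ≠ f → (s e * star (s e)) * (s f * star (s f)) = 0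
  star_s_mul_s : ∀ e, star (s e) * s e = p (E.range e)
  range_le : ∀ e, p (E.source e) * (s e * star (s e)) = s e * star (s e)
  sum_range : ∀ (v : E.Vertex) (h : {e : E.Edge | E.source e = v}.Finite),
    {e : E.Edge | E.source e = v}.Nonempty → p v = ∑ e ∈ h.toFinset, s e * star (s e)

theorem CuntzKriegerFamily.norm_s_le {E : DirectedGraph.{u}} {A : Type*} [NonUnitalCStarAlgebra A]
    (t : CuntzKriegerFamily E A) (e : E.Edge) : ‖t.s e‖ ≤ 1 := by
  have h := (t.isStarProjection_p (E.range e)).norm_le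
  rw [← t.star_s_mul_s, CStarRing.norm_star_mul_self] at h
  nlinarith [norm_nonneg (t.s e)]

/-- A Cuntz–Krieger `E`-family of bounded operators on some Hilbert space. -/
structure CuntzKriegerRepresentation (E : DirectedGraph.{u}) where
  Space : Type u
  [normedAddCommGroup : NormedAddCommGroup Space]
  [innerProductSpace : InnerProductSpace ℂ Space]
  [completeSpace : CompleteSpace Space]
  family : CuntzKriegerFamily E (Space →L[ℂ] Space)

attribute [instance] CuntzKriegerRepresentation.normedAddCommGroup
  CuntzKriegerRepresentation.innerProductSpace CuntzKriegerRepresentation.completeSpace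

/-- The C⋆-algebra of all bounded families `(T_π)` of operators `T_π ∈ B(H_π)`, with the supremum
norm, where `π` runs through all Cuntz–Krieger `E`-families on Hilbert spaces. -/
def UniversalOperatorAlgebra (E : DirectedGraph.{u}) : Type (u + 1) :=
  lp (fun π : CuntzKriegerRepresentation E => π.Space →L[ℂ] π.Space) ∞

noncomputable instance UniversalOperatorAlgebra.instNonUnitalCStarAlgebra
    (E : DirectedGraph.{u}) : NonUnitalCStarAlgebra (UniversalOperatorAlgebra E) :=
  inferInstanceAs (NonUnitalCStarAlgebra
    (lp (fun π : CuntzKriegerRepresentation E => π.Space →L[ℂ] π.Space) ∞))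

/-- The projection of the algebra of bounded families to the coordinate `π`. -/
noncomputable def UniversalOperatorAlgebra.eval {E : DirectedGraph.{u}}
    (π : CuntzKriegerRepresentation E) :
    UniversalOperatorAlgebra E →⋆ₙₐ[ℂ] (π.Space →L[ℂ] π.Space) where
  toFun x := x.1 π
  map_smul' _ _ := rfl
  map_zero' := rfl
  map_add' _ _ := rfl
  map_mul' _ _ := rfl
  map_star' _ := rfl

/-- The family of all projections `P_v^π`. -/
noncomputable def universalP (E : DirectedGraph.{u}) (v : E.Vertex) : UniversalOperatorAlgebra E :=
  ⟨fun π => π.family.p v, memℓp_infty ⟨1, by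
    rintro _ ⟨π, rfl⟩
    exact (π.family.isStarProjection_p v).norm_le⟩⟩

/-- The family of all partial isometries `S_e^π`. -/
noncomputable def universalS (E : DirectedGraph.{u}) (e : E.Edge) : UniversalOperatorAlgebra E :=
  ⟨fun π => π.family.s e, memℓp_infty ⟨1, by
    rintro _ ⟨π, rfl⟩
    exact π.family.norm_s_le e⟩⟩

/-- The closed `*`-subalgebra generated by the universal Cuntz–Krieger family. -/
noncomputable def graphCStarSubalgebra (E : DirectedGraph.{u}) :
    NonUnitalStarSubalgebra ℂ (UniversalOperatorAlgebra E) :=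
  (NonUnitalStarAlgebra.adjoin ℂ
    (Set.range (universalP E) ∪ Set.range (universalS E))).topologicalClosure

/-- The graph C⋆-algebra `C⋆(E)`: the universal C⋆-algebra generated by a Cuntz–Krieger
`E`-family. As usual for C⋆-algebras given by generators and relations, it is the completion of the
`*`-algebra generated by the family in the norm `‖x‖ = sup_π ‖π(x)‖` over all families on Hilbert
spaces (as `E` is countable, Hilbert spaces of arbitrarily small universe suffice). -/
def GraphCStarAlgebra (E : DirectedGraph.{u}) : Type (u + 1) :=
  ↥(graphCStarSubalgebra E)

noncomputable instance GraphCStarAlgebra.instNonUnitalCStarAlgebra (E : DirectedGraph.{u}) :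
    NonUnitalCStarAlgebra (GraphCStarAlgebra E) :=
  NonUnitalStarSubalgebra.nonUnitalCStarAlgebra (graphCStarSubalgebra E)
    (h_closed := NonUnitalStarSubalgebra.isClosed_topologicalClosure _)

/-- The inclusion of `C⋆(E)` into the algebra of bounded families. -/
noncomputable def GraphCStarAlgebra.incl (E : DirectedGraph.{u}) :
    GraphCStarAlgebra E →⋆ₙₐ[ℂ] UniversalOperatorAlgebra E :=
  NonUnitalStarSubalgebraClass.subtype (graphCStarSubalgebra E)

/-- The `*`-representation of `C⋆(E)` given by a Cuntz–Krieger `E`-family on a Hilbert space. -/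
noncomputable def GraphCStarAlgebra.rep {E : DirectedGraph.{u}}
    (π : CuntzKriegerRepresentation E) :
    GraphCStarAlgebra E →⋆ₙₐ[ℂ] (π.Space →L[ℂ] π.Space) :=
  (UniversalOperatorAlgebra.eval π).comp (GraphCStarAlgebra.incl E)

theorem GraphCStarAlgebra.ext_rep {E : DirectedGraph.{u}} {x y : GraphCStarAlgebra E}
    (h : ∀ π, rep π x = rep π y) : x = y :=
  Subtype.ext <| Subtype.ext <| funext h

/-- The generating Cuntz–Krieger `E`-family of `C⋆(E)`. -/
noncomputable def GraphCStarAlgebra.family (E : DirectedGraph.{u}) :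
    CuntzKriegerFamily E (GraphCStarAlgebra E) where
  p v := ⟨universalP E v, NonUnitalStarSubalgebra.le_topologicalClosure _
    (NonUnitalStarAlgebra.subset_adjoin ℂ _ (Or.inl ⟨v, rfl⟩))⟩
  s e := ⟨universalS E e, NonUnitalStarSubalgebra.le_topologicalClosure _
    (NonUnitalStarAlgebra.subset_adjoin ℂ _ (Or.inr ⟨e, rfl⟩))⟩
  isStarProjection_p v :=
    ⟨ext_rep fun π => (π.family.isStarProjection_p v).1,
      ext_rep fun π => (π.family.isStarProjection_p v).2⟩
  p_mul_p v w h := ext_rep fun π => π.family.p_mul_p v w h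
  isPartialIsometry_s e := ext_rep fun π => π.family.isPartialIsometry_s e
  range_mul_range e f h := ext_rep fun π => π.family.range_mul_range e f h
  star_s_mul_s e := ext_rep fun π => π.family.star_s_mul_s e
  range_le e := ext_rep fun π => π.family.range_le e
  sum_range v h hne := ext_rep fun π => by
    rw [map_sum]
    exact π.family.sum_range v h hne

/-- `*`-homomorphisms on `C⋆(E)` are determined by their values on the generating family. -/
theorem GraphCStarAlgebra.hom_ext {E : DirectedGraph.{u}} {B : Type*} [NonUnitalCStarAlgebra B]
    {φ ψ : GraphCStarAlgebra E →⋆ₙₐ[ℂ] B}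
    (hp : ∀ v, φ ((family E).p v) = ψ ((family E).p v))
    (hs : ∀ e, φ ((family E).s e) = ψ ((family E).s e)) : φ = ψ := by
  have hφ : Continuous φ := AddMonoidHomClass.continuous_of_bound φ 1 fun a => by
    simpa using NonUnitalStarAlgHom.norm_apply_le φ a
  have hψ : Continuous ψ := AddMonoidHomClass.continuous_of_bound ψ 1 fun a => by
    simpa using NonUnitalStarAlgHom.norm_apply_le ψ a
  have hcl : IsClosed (graphCStarSubalgebra E : Set (UniversalOperatorAlgebra E)) :=
    NonUnitalStarSubalgebra.isClosed_topologicalClosure _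
  let S : NonUnitalStarSubalgebra ℂ (UniversalOperatorAlgebra E) :=
    (NonUnitalStarAlgHom.equalizer φ ψ).map (incl E)
  have hS : graphCStarSubalgebra E ≤ S := by
    refine NonUnitalStarSubalgebra.topologicalClosure_minimal _ ?_ ?_
    · refine NonUnitalStarAlgebra.adjoin_le ?_
      rintro _ (⟨v, rfl⟩ | ⟨e, rfl⟩)
      · exact ⟨(family E).p v, hp v, rfl⟩
      · exact ⟨(family E).s e, hs e, rfl⟩
    · exact hcl.isClosedEmbedding_subtypeVal.isClosedMap _ (isClosed_eq hφ hψ)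
  ext ⟨x, hx⟩
  obtain ⟨y, hy, rfl⟩ := hS hx
  exact hy

/-- The universal property: every Cuntz–Krieger `E`-family on a Hilbert space comes from exactly one
`*`-representation of `C⋆(E)`. -/
theorem GraphCStarAlgebra.existsUnique_representation (E : DirectedGraph.{u}) (H : Type u)
    [NormedAddCommGroup H] [InnerProductSpace ℂ H] [CompleteSpace H]
    (t : CuntzKriegerFamily E (H →L[ℂ] H)) :
    ∃! φ : GraphCStarAlgebra E →⋆ₙₐ[ℂ] (H →L[ℂ] H),
      (∀ v, φ ((family E).p v) = t.p v) ∧ ∀ e, φ ((family E).s e) = t.s e :=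
  ⟨rep ⟨H, t⟩, ⟨fun _ => rfl, fun _ => rfl⟩, fun _ hψ =>
    hom_ext (fun v => hψ.1 v) (fun e => hψ.2 e)⟩

/-! ### Morita equivalence -/

/-- An `A`–`B` imprimitivity bimodule structure on the Banach space `X`: a full left Hilbert
`A`-module and full right Hilbert `B`-module, each algebra acting by adjointable operators for the
inner product of the other, with `⟪x, y⟫_A • z = x • ⟪y, z⟫_B`. Here `lact a x` is `a • x`,
`ract b x` is `x • b`; positive elements of a C⋆-algebra are those of the form `star a * a`. -/
structure ImprimitivityBimodule (A B X : Type*) [NonUnitalCStarAlgebra A]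
    [NonUnitalCStarAlgebra B] [NormedAddCommGroup X] [NormedSpace ℂ X] [CompleteSpace X] where
  lact : A →ₗ[ℂ] X →ₗ[ℂ] X
  ract : B →ₗ[ℂ] X →ₗ[ℂ] X
  linner : X →ₗ[ℂ] X →ₗ⋆[ℂ] A
  rinner : X →ₗ⋆[ℂ] X →ₗ[ℂ] B
  lact_mul : ∀ a a' x, lact (a * a') x = lact a (lact a' x)
  ract_mul : ∀ b b' x, ract (b * b') x = ract b' (ract b x)
  lact_ract : ∀ a b x, lact a (ract b x) = ract b (lact a x)
  linner_lact : ∀ a x y, linner (lact a x) y = a * linner x y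
  rinner_ract : ∀ b x y, rinner x (ract b y) = rinner x y * b
  star_linner : ∀ x y, star (linner x y) = linner y x
  star_rinner : ∀ x y, star (rinner x y) = rinner y x
  linner_self_nonneg : ∀ x, ∃ a, linner x x = star a * a
  rinner_self_nonneg : ∀ x, ∃ b, rinner x x = star b * b
  norm_linner_self : ∀ x, ‖linner x x‖ = ‖x‖ ^ 2
  norm_rinner_self : ∀ x, ‖rinner x x‖ = ‖x‖ ^ 2
  rinner_lact : ∀ a x y, rinner (lact a x) y = rinner x (lact (star a) y)
  linner_ract : ∀ b x y, linner (ract b x) y = linner x (ract (star b) y)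
  lact_linner : ∀ x y z, lact (linner x y) z = ract (rinner y z) x
  dense_linner : Dense (Submodule.span ℂ {a : A | ∃ x y, linner x y = a} : Set A)
  dense_rinner : Dense (Submodule.span ℂ {b : B | ∃ x y, rinner x y = b} : Set B)

/-- Two C⋆-algebras are (strongly) Morita equivalent if there is an imprimitivity bimodule. -/
def MoritaEquivalent (A B : Type u) [NonUnitalCStarAlgebra A] [NonUnitalCStarAlgebra B] : Prop :=
  ∃ (X : Type u) (_ : NormedAddCommGroup X) (_ : NormedSpace ℂ X) (_ : CompleteSpace X),
    Nonempty (ImprimitivityBimodule A B X)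

/-! Suppose `A_E = R S` and `A_F = S R`. Draw `R i k` edges from vertices `i` of `E` to vertices `k`
of `F`, and `S k i` edges back. Counting matches edges of `E` with paths `rs` and edges of `F` with
paths `sr` (`nonempty_shiftLink`). If partial isometries `z r`, `w s` satisfy the Cuntz–Krieger
relations of this bipartite picture, then the products `z r * w s` form an `E`-family and the
products `w s * z r` an `F`-family. The closed span `X` of `C⋆(E)·{z r, star (w s)}` satisfies: `X
X*` spans the image of `C⋆(E)` densely, and `X* X` that of `C⋆(F)`
(`ShiftFamily.linkedBy_bimodule`). If both images are faithful, `X` is an imprimitivity bimodule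
with inner products `x y*` and `x* y`.

Such `z`, `w` can be built on top of any given `E`-family in an algebra `D` containing infinitely
many isometries with orthogonal ranges (`ShiftLink.exists_shiftFamily`). The projections for `E` and
for `F` need not be orthogonal to each other, so no linking algebra is formed.

Faithfulness comes without a uniqueness theorem (`ShiftFamily.injective_of_injective`). Let `T` have
a faithful `E`-part and let `T'`, built from the other side, have a faithful `F`-part. Both parts of
`T ⊕ T'` are faithful, so they are linked by some `X`. If the `F`-part of `T` kills `b`, then `X b
X*` lies in the image of `C⋆(E)` and has zero `T`-coordinate, hence vanishes, and fullness gives `b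
= 0`.

Hence every faithful copy of `C⋆(E)` in a large enough `D` is linked to a faithful copy of `C⋆(F)`
in the same `D`. Along a chain of elementary equivalences the bimodules are multiplied inside one
fixed `D` (`LinkedBy.trans`), which replaces tensor products. A suitable `D` is the algebra of
bounded families of operators on the `ℓ²`-amplifications of all Cuntz–Krieger representations. -/

/-! ### Factorizations of graphs -/

/-- A factorization of the edges of `E` and `F` through two sets of edges, one leading from the
vertices of `E` to those of `F` and one leading back: the edges of `E` and `F` are the paths of
length two in the resulting bipartite graph. -/
structure ShiftLink (E F : DirectedGraph.{u}) where
  Left : Type u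
  Right : Type u
  countable_left : Countable Left
  countable_right : Countable Right
  leftSource : Left → E.Vertex
  leftRange : Left → F.Vertex
  rightSource : Right → F.Vertex
  rightRange : Right → E.Vertex
  leftOut : E.Vertex → Finset Left
  mem_leftOut : ∀ {v r}, r ∈ leftOut v ↔ leftSource r = v
  rightOut : F.Vertex → Finset Right
  mem_rightOut : ∀ {k s}, s ∈ rightOut k ↔ rightSource s = k
  edgeE : E.Edge ≃ {x : Left × Right // leftRange x.1 = rightSource x.2}
  source_edgeE : ∀ e, leftSource (edgeE e).1.1 = E.source e
  range_edgeE : ∀ e, rightRange (edgeE e).1.2 = E.range e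
  edgeF : F.Edge ≃ {x : Right × Left // rightRange x.1 = leftSource x.2}
  source_edgeF : ∀ f, rightSource (edgeF f).1.1 = F.source f
  range_edgeF : ∀ f, leftRange (edgeF f).1.2 = F.range f

/-- Exchange the two graphs. -/
def ShiftLink.symm {E F : DirectedGraph.{u}} (L : ShiftLink E F) : ShiftLink F E where
  Left := L.Right
  Right := L.Left
  countable_left := L.countable_right
  countable_right := L.countable_left
  leftSource := L.rightSource
  leftRange := L.rightRange
  rightSource := L.leftSource
  rightRange := L.leftRange
  leftOut := L.rightOut
  mem_leftOut := L.mem_rightOut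
  rightOut := L.leftOut
  mem_rightOut := L.mem_leftOut
  edgeE := L.edgeF
  source_edgeE := L.source_edgeF
  range_edgeE := L.range_edgeF
  edgeF := L.edgeE
  source_edgeF := L.source_edgeE
  range_edgeF := L.range_edgeE

/-! ### Matching edges with paths of length two. -/

theorem exists_equiv_of_card_fiber_eq {α β I : Type*} (f : α → I) (g : β → I)
    (hf : ∀ i, Finite {a // f a = i}) (hg : ∀ i, Finite {b // g b = i})
    (h : ∀ i, Nat.card {a // f a = i} = Nat.card {b // g b = i}) :
    ∃ e : α ≃ β, ∀ a, g (e a) = f a := by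
  have key : ∀ i, Nonempty ({a // f a = i} ≃ {b // g b = i}) := fun i =>
    have := hf i; have := hg i; Finite.card_eq.1 (h i)
  let k := fun i => (key i).some
  refine ⟨(Equiv.sigmaFiberEquiv f).symm.trans
    ((Equiv.sigmaCongrRight k).trans (Equiv.sigmaFiberEquiv g)), fun a => ?_⟩
  exact (k (f a) ⟨a, rfl⟩).2

/-- The edges of the graph with adjacency matrix `R`, between two sets of vertices. -/
structure MatrixEdge {ι κ : Type*} (R : Matrix ι κ ℕ) where
  source : ι
  range : κ
  index : Fin (R source range)

theorem MatrixEdge.injective_toProd {ι κ : Type*} (R : Matrix ι κ ℕ) :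
    Function.Injective fun e : MatrixEdge R => (e.source, e.range, (e.index : ℕ)) := by
  rintro ⟨i, k, a⟩ ⟨i', k', a'⟩ h
  simp only [Prod.mk.injEq] at h
  obtain ⟨rfl, rfl, h⟩ := h
  rw [Fin.ext h]

instance MatrixEdge.instCountable {ι κ : Type*} [Countable ι] [Countable κ] (R : Matrix ι κ ℕ) :
    Countable (MatrixEdge R) :=
  (injective_toProd R).countable

theorem finite_and_card_sigma_of_hasSum {κ : Type*} {T : κ → Type*} [∀ k, Finite (T k)] {n : ℕ}
    (h : HasSum (fun k => Nat.card (T k)) n) :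
    Finite (Σ k, T k) ∧ Nat.card (Σ k, T k) = n := by
  -- A summable family in a discrete group has finite support; the cast to `ℤ` provides the group.
  have h' : HasSum (fun k => ((Nat.card (T k) : ℕ) : ℤ)) (n : ℤ) :=
    h.map (Nat.castAddMonoidHom ℤ) continuous_of_discreteTopology
  have hfin : (Function.support fun k => ((Nat.card (T k) : ℕ) : ℤ)).Finite :=
    h'.summable.hasFiniteSupport_of_discreteTopology
  let s := hfin.toFinset
  have hs : ∀ k, k ∉ s → Nat.card (T k) = 0 := fun k hk => by
    simpa [s] using hk
  have hmem : ∀ (k) (_ : T k), k ∈ s := fun k x => by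
    by_contra hk
    have : Nonempty (T k) := ⟨x⟩
    exact Nat.card_pos.ne' (hs k hk)
  let g : (Σ k : s, T k) ≃ Σ k, T k :=
    { toFun := fun x => ⟨x.1, x.2⟩
      invFun := fun x => ⟨⟨x.1, hmem x.1 x.2⟩, x.2⟩
      left_inv := fun _ => rfl
      right_inv := fun _ => rfl }
  refine ⟨Finite.of_equiv _ g, ?_⟩
  rw [← Nat.card_congr g, Nat.card_sigma, Finset.sum_coe_sort s fun k => Nat.card (T k)]
  exact (hasSum_sum_of_ne_finset_zero (fun k hk => hs k hk)).unique h

/-- Both sides are fibred over pairs `(v, w)` of endpoints. There are `∑ k, R v k * S k w` paths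
from `v` to `w`, which is the number of edges, so the finite fibres can be matched one by one. -/
theorem exists_edge_equiv {E : DirectedGraph.{u}} (hE : E.IsRegular) {κ : Type*}
    {R : Matrix E.Vertex κ ℕ} {S : Matrix κ E.Vertex ℕ} (h : IsMatrixProduct R S E.vertexMatrix) :
    ∃ e : E.Edge ≃ {x : MatrixEdge R × MatrixEdge S // x.1.range = x.2.source},
      (∀ a, (e a).1.1.source = E.source a) ∧ ∀ a, (e a).1.2.range = E.range a := by
  let g : {x : MatrixEdge R × MatrixEdge S // x.1.range = x.2.source} → E.Vertex × E.Vertex :=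
    fun x => (x.1.1.source, x.1.2.range)
  have hg : ∀ i : E.Vertex × E.Vertex, Finite {b // g b = i} ∧
      Nat.card {b // g b = i} = E.vertexMatrix i.1 i.2 := by
    rintro ⟨v, w⟩
    have h1 := finite_and_card_sigma_of_hasSum (T := fun k => Fin (R v k) × Fin (S k w))
      (n := E.vertexMatrix v w) (by simpa using h v w)
    let eqv : (Σ k, Fin (R v k) × Fin (S k w)) ≃ {b // g b = (v, w)} :=
      { toFun := fun x => ⟨⟨(⟨v, x.1, x.2.1⟩, ⟨x.1, w, x.2.2⟩), rfl⟩, rfl⟩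
        invFun := fun y => match y with
          | ⟨⟨(⟨v', k, a⟩, ⟨k', w', b⟩), hk⟩, hy⟩ =>
            ⟨k, Fin.cast (by cases (Prod.mk.inj hy).1; rfl) a,
              Fin.cast (by cases (Prod.mk.inj hy).2; cases hk; rfl) b⟩
        left_inv := fun _ => rfl
        right_inv := by
          rintro ⟨⟨⟨⟨v', k, a⟩, ⟨k', w', b⟩⟩, hk⟩, hy⟩
          cases hy
          cases hk
          rfl }
    exact ⟨have := h1.1; Finite.of_equiv _ eqv, (Nat.card_congr eqv).symm.trans h1.2⟩
  have hf : ∀ i : E.Vertex × E.Vertex,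
      Finite {e : E.Edge // (E.source e, E.range e) = i} ∧
      Nat.card {e : E.Edge // (E.source e, E.range e) = i} = E.vertexMatrix i.1 i.2 := by
    rintro ⟨v, w⟩
    constructor
    · exact ((hE v).1.subset fun e (he : (E.source e, E.range e) = (v, w)) =>
        (Prod.mk.inj he).1 : {e : E.Edge | (E.source e, E.range e) = (v, w)}.Finite)
    · simp only [DirectedGraph.vertexMatrix, Matrix.of_apply, ← Nat.card_coe_set_eq]
      exact Nat.card_congr (Equiv.subtypeEquivRight fun e => by simp)
  obtain ⟨e, he⟩ := exists_equiv_of_card_fiber_eq (fun e : E.Edge => (E.source e, E.range e)) g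
    (fun i => (hf i).1) (fun i => (hg i).1) fun i => (hf i).2.trans (hg i).2.symm
  exact ⟨e, fun a => congrArg Prod.fst (he a), fun a => congrArg Prod.snd (he a)⟩

/-- Finiteness of the rows of `R` is not assumed. Since `F` is regular, every `r` extends to a path
`rs`, so it is the first half of an edge of `E` with the same source, and only finitely many such
edges exist. -/
theorem finite_matrixEdge_source {E F : DirectedGraph.{u}} (hE : E.IsRegular) (hF : F.IsRegular)
    {R : Matrix E.Vertex F.Vertex ℕ} {S : Matrix F.Vertex E.Vertex ℕ}
    (e : E.Edge ≃ {x : MatrixEdge R × MatrixEdge S // x.1.range = x.2.source})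
    (he : ∀ a, (e a).1.1.source = E.source a)
    (f : F.Edge ≃ {x : MatrixEdge S × MatrixEdge R // x.1.range = x.2.source})
    (hf : ∀ a, (f a).1.1.source = F.source a) (v : E.Vertex) :
    {r : MatrixEdge R | r.source = v}.Finite := by
  refine ((hE v).1.image fun a => (e a).1.1).subset ?_
  intro r hr
  -- The first half of any edge of `F` leaving `r.range` serves as the continuation of `r`.
  obtain ⟨b, hb⟩ := (hF r.range).2
  have hs : r.range = (f b).1.1.source := (hb.symm.trans (hf b).symm)
  refine ⟨e.symm ⟨(r, (f b).1.1), hs⟩, ?_, by simp⟩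
  have := he (e.symm ⟨(r, (f b).1.1), hs⟩)
  simp only [Equiv.apply_symm_apply] at this
  exact this.symm.trans hr

theorem nonempty_shiftLink {E F : DirectedGraph.{u}} (hE : E.IsRegular) (hF : F.IsRegular)
    {R : Matrix E.Vertex F.Vertex ℕ} {S : Matrix F.Vertex E.Vertex ℕ}
    (hRS : IsMatrixProduct R S E.vertexMatrix) (hSR : IsMatrixProduct S R F.vertexMatrix) :
    Nonempty (ShiftLink E F) := by
  obtain ⟨e, he, he'⟩ := exists_edge_equiv hE hRS
  obtain ⟨f, hf, hf'⟩ := exists_edge_equiv hF hSR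
  have := E.countable_vertex
  have := F.countable_vertex
  exact ⟨{
    Left := MatrixEdge R
    Right := MatrixEdge S
    countable_left := inferInstance
    countable_right := inferInstance
    leftSource := fun r => r.source
    leftRange := fun r => r.range
    rightSource := fun s => s.source
    rightRange := fun s => s.range
    leftOut := fun v => (finite_matrixEdge_source hE hF e he f hf v).toFinset
    mem_leftOut := by simp
    rightOut := fun k => (finite_matrixEdge_source hF hE f hf e he k).toFinset
    mem_rightOut := by simp
    edgeE := e
    source_edgeE := he
    range_edgeE := he'
    edgeF := f
    source_edgeF := hf
    range_edgeF := hf' }⟩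

/-! ### Graphs built from matrices. -/

/-- The graph with vertex matrix `A`. -/
def RegularSquareMatrix.graph (A : RegularSquareMatrix.{u}) : DirectedGraph.{u} where
  Vertex := A.Index
  Edge := MatrixEdge A.entry
  source e := e.source
  range e := e.range
  countable_vertex := A.countable_index
  countable_edge := have := A.countable_index; inferInstance

theorem RegularSquareMatrix.graph_isRegular (A : RegularSquareMatrix.{u}) : A.graph.IsRegular := by
  intro v
  obtain ⟨hfin, j, hj⟩ := A.regular v
  refine ⟨?_, ⟨⟨v, j, ⟨0, hj⟩⟩, rfl⟩⟩
  refine (hfin.biUnion fun j _ => Set.finite_range fun n : Fin (A.entry v j) =>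
    (⟨v, j, n⟩ : MatrixEdge A.entry)).subset ?_
  rintro ⟨v', j, n⟩ h
  cases h
  exact Set.mem_biUnion (show j ∈ {j | 0 < A.entry _ j} from n.pos) ⟨n, rfl⟩

theorem MatrixEdge.ncard_eq {ι κ : Type*} (R : Matrix ι κ ℕ) (i : ι) (k : κ) :
    {e : MatrixEdge R | e.source = i ∧ e.range = k}.ncard = R i k := by
  let g : Fin (R i k) ≃ {e : MatrixEdge R | e.source = i ∧ e.range = k} :=
    { toFun := fun n => ⟨⟨i, k, n⟩, rfl, rfl⟩
      invFun := fun e => Fin.cast (by rw [e.2.1, e.2.2]) e.1.index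
      left_inv := fun _ => rfl
      right_inv := by
        rintro ⟨⟨i', k', n⟩, h1, h2⟩
        cases h1
        cases h2
        rfl }
  rw [← Nat.card_coe_set_eq, ← Nat.card_congr g, Nat.card_fin]

theorem RegularSquareMatrix.graph_vertexMatrix (A : RegularSquareMatrix.{u}) :
    A.graph.vertexMatrix = A.entry := by
  ext v w
  exact MatrixEdge.ncard_eq A.entry v w

theorem isMatrixProduct_one_left {ι κ : Type*} [DecidableEq ι] (A : Matrix ι κ ℕ) :
    IsMatrixProduct 1 A A := by
  intro i j
  convert hasSum_single i fun k hk => ?_ using 1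
  · simp
  · simp [Matrix.one_apply_ne hk.symm]

theorem isMatrixProduct_one_right {ι κ : Type*} [DecidableEq κ] (A : Matrix ι κ ℕ) :
    IsMatrixProduct A 1 A := by
  intro i j
  convert hasSum_single j fun k hk => ?_ using 1
  · simp
  · simp [Matrix.one_apply_ne hk]

/-! ### Bimodules inside a C⋆-algebra -/

/-- The closed linear span. -/
noncomputable def closedSpan {D : Type*} [NonUnitalCStarAlgebra D] (S : Set D) : Submodule ℂ D :=
  (Submodule.span ℂ S).topologicalClosure

section ClosedSpan

variable {D : Type*} [NonUnitalCStarAlgebra D]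

theorem isClosed_closedSpan (S : Set D) : IsClosed (closedSpan S : Set D) :=
  Submodule.isClosed_topologicalClosure _

theorem subset_closedSpan {S : Set D} {x : D} (hx : x ∈ S) : x ∈ closedSpan S :=
  Submodule.le_topologicalClosure _ (Submodule.subset_span hx)

theorem closedSpan_induction {S : Set D} {P : D → Prop} (mem : ∀ x ∈ S, P x) (zero : P 0)
    (add : ∀ x y, P x → P y → P (x + y)) (smul : ∀ (c : ℂ) x, P x → P (c • x))
    (closed : IsClosed {x | P x}) {x : D} (hx : x ∈ closedSpan S) : P x := by
  have h : closedSpan S ≤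
      ({ carrier := {x | P x}, add_mem' := fun ha hb => add _ _ ha hb, zero_mem' := zero,
         smul_mem' := fun c _ h => smul c _ h } : Submodule ℂ D) :=
    Submodule.topologicalClosure_minimal _ (Submodule.span_le.2 mem) closed
  exact h hx

theorem closedSpan_le {S : Set D} {N : Submodule ℂ D} (hN : IsClosed (N : Set D))
    (h : ∀ x ∈ S, x ∈ N) : closedSpan S ≤ N :=
  Submodule.topologicalClosure_minimal _ (Submodule.span_le.2 h) hN

theorem mul_left_mem_of_mem_closedSpan {S : Set D} {N : Submodule ℂ D}
    (hN : IsClosed (N : Set D)) {a x : D} (h : ∀ s ∈ S, a * s ∈ N) (hx : x ∈ closedSpan S) :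
    a * x ∈ N :=
  closedSpan_induction (P := fun x => a * x ∈ N) h (by simp)
    (fun x y hx hy => by simpa [mul_add] using N.add_mem hx hy)
    (fun c x hx => by simpa only [mul_smul_comm] using N.smul_mem c hx)
    (hN.preimage (continuous_const_mul a)) hx

theorem mul_right_mem_of_mem_closedSpan {S : Set D} {N : Submodule ℂ D}
    (hN : IsClosed (N : Set D)) {a x : D} (h : ∀ s ∈ S, s * a ∈ N) (hx : x ∈ closedSpan S) :
    x * a ∈ N :=
  closedSpan_induction (P := fun x => x * a ∈ N) h (by simp)
    (fun x y hx hy => by simpa [add_mul] using N.add_mem hx hy)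
    (fun c x hx => by simpa only [smul_mul_assoc] using N.smul_mem c hx)
    (hN.preimage (continuous_mul_const a)) hx

theorem star_mem_of_mem_closedSpan {S : Set D} {N : Submodule ℂ D}
    (hN : IsClosed (N : Set D)) {x : D} (h : ∀ s ∈ S, star s ∈ N) (hx : x ∈ closedSpan S) :
    star x ∈ N :=
  closedSpan_induction (P := fun x => star x ∈ N) h (by simp)
    (fun x y hx hy => by simpa using N.add_mem hx hy)
    (fun c x hx => by simpa using N.smul_mem (star c) hx)
    (hN.preimage continuous_star) hx

end ClosedSpan

/-- The closed subspace `X` of `D` is an imprimitivity bimodule between the C⋆-subalgebras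
`A` and `B`, with inner products `x * star y` and `star x * y`. -/
structure LinkedBy {D : Type*} [NonUnitalCStarAlgebra D] (A B : NonUnitalStarSubalgebra ℂ D)
    (X : Submodule ℂ D) : Prop where
  isClosed : IsClosed (X : Set D)
  mul_left : ∀ a ∈ A, ∀ x ∈ X, a * x ∈ X
  mul_right : ∀ x ∈ X, ∀ b ∈ B, x * b ∈ X
  mul_star : ∀ x ∈ X, ∀ y ∈ X, x * star y ∈ A
  star_mul : ∀ x ∈ X, ∀ y ∈ X, star x * y ∈ B
  left_dense : ∀ a ∈ A, a ∈ closedSpan (Set.image2 (fun x y => x * star y) X X)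
  right_dense : ∀ b ∈ B, b ∈ closedSpan (Set.image2 (fun x y => star x * y) X X)
  left_nondegenerate : ∀ x ∈ X, x ∈ closedSpan (Set.image2 (fun a y => a * y) A X)
  right_nondegenerate : ∀ x ∈ X, x ∈ closedSpan (Set.image2 (fun y b => y * b) X B)

/-- The closed span of `X Y` plays the role of the tensor product over `B`. Fullness on the left: `x
x'*` is approximated by `x b x'*` with `b` in `B`, and `b` by sums of `y y'*`, giving `(x y)(x'
y')*`. The right side is similar. -/
theorem LinkedBy.trans {D : Type*} [NonUnitalCStarAlgebra D]
    {A B C : NonUnitalStarSubalgebra ℂ D} (hA : IsClosed (A : Set D)) (hC : IsClosed (C : Set D))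
    {X Y : Submodule ℂ D} (hX : LinkedBy A B X) (hY : LinkedBy B C Y) :
    LinkedBy A C (closedSpan (Set.image2 (fun x y => x * y) X Y)) := by
  set Z := closedSpan (Set.image2 (fun x y => x * y) (X : Set D) Y) with hZ
  have hZc : IsClosed (Z : Set D) := isClosed_closedSpan _
  have hZm : ∀ x ∈ X, ∀ y ∈ Y, x * y ∈ Z := fun x hx y hy =>
    subset_closedSpan ⟨x, hx, y, hy, rfl⟩
  have hAc : IsClosed (A.toSubmodule : Set D) := hA
  have hCc : IsClosed (C.toSubmodule : Set D) := hC
  refine ⟨hZc, ?_, ?_, ?_, ?_, ?_, ?_, ?_, ?_⟩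
  · intro a ha z hz
    refine mul_left_mem_of_mem_closedSpan hZc ?_ hz
    rintro _ ⟨x, hx, y, hy, rfl⟩
    simpa only [mul_assoc] using hZm _ (hX.mul_left a ha x hx) y hy
  · intro z hz c hc
    refine mul_right_mem_of_mem_closedSpan hZc ?_ hz
    rintro _ ⟨x, hx, y, hy, rfl⟩
    simpa only [mul_assoc] using hZm x hx _ (hY.mul_right y hy c hc)
  · intro z hz z' hz'
    refine mul_right_mem_of_mem_closedSpan (N := A.toSubmodule) hAc ?_ hz
    rintro _ ⟨x, hx, y, hy, rfl⟩
    -- Passing to the adjoint lets the second variable also be reduced to generators by right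
    -- multiplication.
    suffices z' * star (x * y) ∈ A.toSubmodule by
      simpa using (star_mem this : star (z' * star (x * y)) ∈ A)
    refine mul_right_mem_of_mem_closedSpan (N := A.toSubmodule) hAc ?_ hz'
    rintro _ ⟨x', hx', y', hy', rfl⟩
    change x' * y' * star (x * y) ∈ A
    simpa only [StarMul.star_mul, mul_assoc] using
      hX.mul_star _ (hX.mul_right x' hx' _ (hY.mul_star y' hy' y hy)) x hx
  · intro z hz z' hz'
    refine mul_left_mem_of_mem_closedSpan (N := C.toSubmodule) hCc ?_ hz'
    rintro _ ⟨x, hx, y, hy, rfl⟩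
    suffices star (x * y) * z ∈ C.toSubmodule by
      simpa using (star_mem this : star (star (x * y) * z) ∈ C)
    refine mul_left_mem_of_mem_closedSpan (N := C.toSubmodule) hCc ?_ hz
    rintro _ ⟨x', hx', y', hy', rfl⟩
    change star (x * y) * (x' * y') ∈ C
    simpa only [StarMul.star_mul, mul_assoc] using
      hY.star_mul y hy _ (hY.mul_left _ (hX.star_mul x hx x' hx') y' hy')
  · intro a ha
    refine closedSpan_le (isClosed_closedSpan _) ?_ (hX.left_dense a ha)
    rintro _ ⟨x, hx, x', hx', rfl⟩
    refine mul_right_mem_of_mem_closedSpan (isClosed_closedSpan _) ?_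
      (hX.right_nondegenerate x hx)
    rintro _ ⟨x, hx, b, hb, rfl⟩
    rw [mul_assoc]
    -- The singleton factor carries the fixed `star x'` along while `b` is approximated by sums of
    -- `y y'*`.
    refine mul_left_mem_of_mem_closedSpan (isClosed_closedSpan _)
      (S := Set.image2 (fun d w => d * w) (Set.image2 (fun x y => x * star y) (Y : Set D) Y)
        {star x'}) ?_ ?_
    · rintro _ ⟨_, ⟨y, hy, y', hy', rfl⟩, w, hw, rfl⟩
      obtain rfl : w = star x' := hw
      refine subset_closedSpan ⟨x * y, hZm x hx y hy, x' * y', hZm x' hx' y' hy', ?_⟩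
      simp [mul_assoc]
    · refine mul_right_mem_of_mem_closedSpan (isClosed_closedSpan _) ?_ (hY.left_dense b hb)
      exact fun d hd => subset_closedSpan ⟨d, hd, _, rfl, rfl⟩
  · intro c hc
    refine closedSpan_le (isClosed_closedSpan _) ?_ (hY.right_dense c hc)
    rintro _ ⟨y', hy', y, hy, rfl⟩
    refine mul_left_mem_of_mem_closedSpan (isClosed_closedSpan _) ?_
      (hY.left_nondegenerate y hy)
    rintro _ ⟨b, hb, y, hy, rfl⟩
    change star y' * (b * y) ∈ _
    refine mul_left_mem_of_mem_closedSpan (isClosed_closedSpan _)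
      (S := Set.image2 (fun d w => d * w) (Set.image2 (fun x y => star x * y) (X : Set D) X)
        {y}) ?_ ?_
    · rintro _ ⟨_, ⟨x, hx, x', hx', rfl⟩, w, hw, rfl⟩
      obtain rfl : w = y := hw
      refine subset_closedSpan ⟨x * y', hZm x hx y' hy', x' * w, hZm x' hx' w hy, ?_⟩
      simp [mul_assoc]
    · refine mul_right_mem_of_mem_closedSpan (isClosed_closedSpan _) ?_ (hX.right_dense b hb)
      exact fun d hd => subset_closedSpan ⟨d, hd, _, rfl, rfl⟩
  · intro z hz
    refine closedSpan_le (isClosed_closedSpan _) ?_ hz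
    rintro _ ⟨x, hx, y, hy, rfl⟩
    refine mul_right_mem_of_mem_closedSpan (isClosed_closedSpan _) ?_
      (hX.left_nondegenerate x hx)
    rintro _ ⟨a, ha, x, hx, rfl⟩
    exact subset_closedSpan ⟨a, ha, x * y, hZm x hx y hy, (mul_assoc _ _ _).symm⟩
  · intro z hz
    refine closedSpan_le (isClosed_closedSpan _) ?_ hz
    rintro _ ⟨x, hx, y, hy, rfl⟩
    refine mul_left_mem_of_mem_closedSpan (isClosed_closedSpan _) ?_
      (hY.right_nondegenerate y hy)
    rintro _ ⟨y, hy, c, hc, rfl⟩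
    exact subset_closedSpan ⟨x * y, hZm x hx y hy, c, hc, mul_assoc _ _ _⟩

/-! ### Homomorphisms of graph algebras -/

/-- A closed `*`-subalgebra of `C⋆(E)` containing the generators is everything. -/
theorem GraphCStarAlgebra.mem_of_isClosed {E : DirectedGraph.{u}}
    (S : NonUnitalStarSubalgebra ℂ (GraphCStarAlgebra E))
    (hS : IsClosed (S : Set (GraphCStarAlgebra E))) (hp : ∀ v, (family E).p v ∈ S)
    (hs : ∀ e, (family E).s e ∈ S) (x : GraphCStarAlgebra E) : x ∈ S := by
  have hcl : IsClosed (graphCStarSubalgebra E : Set (UniversalOperatorAlgebra E)) :=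
    NonUnitalStarSubalgebra.isClosed_topologicalClosure _
  have h : graphCStarSubalgebra E ≤ S.map (incl E) := by
    refine NonUnitalStarSubalgebra.topologicalClosure_minimal _ ?_ ?_
    · refine NonUnitalStarAlgebra.adjoin_le ?_
      rintro _ (⟨v, rfl⟩ | ⟨e, rfl⟩)
      · exact ⟨(family E).p v, hp v, rfl⟩
      · exact ⟨(family E).s e, hs e, rfl⟩
    · exact hcl.isClosedEmbedding_subtypeVal.isClosedMap _ hS
  obtain ⟨x, hx⟩ := x
  obtain ⟨y, hy, rfl⟩ := h hx
  exact hy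

/-- The homomorphism `φ` sends the generators of `C⋆(E)` to the family `t`. -/
structure CuntzKriegerFamily.IsImplementedBy {E : DirectedGraph.{u}} {D : Type*}
    [NonUnitalCStarAlgebra D] (t : CuntzKriegerFamily E D)
    (φ : GraphCStarAlgebra E →⋆ₙₐ[ℂ] D) : Prop where
  map_p : ∀ v, φ ((GraphCStarAlgebra.family E).p v) = t.p v
  map_s : ∀ e, φ ((GraphCStarAlgebra.family E).s e) = t.s e

section Hom

variable {E : DirectedGraph.{u}} {D : Type*} [NonUnitalCStarAlgebra D]
  {t : CuntzKriegerFamily E D} {φ : GraphCStarAlgebra E →⋆ₙₐ[ℂ] D}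

theorem NonUnitalStarAlgHom.continuous_of_cstar {A B : Type*} [NonUnitalCStarAlgebra A]
    [NonUnitalCStarAlgebra B] (φ : A →⋆ₙₐ[ℂ] B) : Continuous φ :=
  AddMonoidHomClass.continuous_of_bound φ 1 fun a => by
    simpa using NonUnitalStarAlgHom.norm_apply_le φ a

theorem NonUnitalStarAlgHom.isClosed_range_of_injective {A B : Type*} [NonUnitalCStarAlgebra A]
    [NonUnitalCStarAlgebra B] (φ : A →⋆ₙₐ[ℂ] B) (hφ : Function.Injective φ) :
    IsClosed (NonUnitalStarAlgHom.range φ : Set B) := by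
  have := (NonUnitalStarAlgHom.isometry φ hφ).isClosedEmbedding.isClosed_range
  simpa [NonUnitalStarAlgHom.coe_range] using this

/-- The preimage of `S` is a closed `*`-subalgebra containing the generators. Statements about the
whole image of `C⋆(E)` are thereby reduced to `t.p v` and `t.s e`. -/
theorem CuntzKriegerFamily.IsImplementedBy.range_le (h : t.IsImplementedBy φ)
    (S : NonUnitalStarSubalgebra ℂ D) (hS : IsClosed (S : Set D)) (hp : ∀ v, t.p v ∈ S)
    (hs : ∀ e, t.s e ∈ S) : NonUnitalStarAlgHom.range φ ≤ S := by
  rintro _ ⟨x, rfl⟩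
  refine GraphCStarAlgebra.mem_of_isClosed (S.comap φ)
    (hS.preimage φ.continuous_of_cstar) (fun v => ?_) (fun e => ?_) x
  · change φ _ ∈ S
    rw [h.map_p]
    exact hp v
  · change φ _ ∈ S
    rw [h.map_s]
    exact hs e

theorem CuntzKriegerFamily.IsImplementedBy.p_mem_range (h : t.IsImplementedBy φ) (v : E.Vertex) :
    t.p v ∈ NonUnitalStarAlgHom.range φ :=
  ⟨_, h.map_p v⟩

theorem CuntzKriegerFamily.IsImplementedBy.s_mem_range (h : t.IsImplementedBy φ) (e : E.Edge) :
    t.s e ∈ NonUnitalStarAlgHom.range φ :=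
  ⟨_, h.map_s e⟩

end Hom

/-! ### Families of partial isometries over a factorization -/

theorem ShiftLink.sum_edgeE {E F : DirectedGraph.{u}} (L : ShiftLink E F) {M : Type*}
    [AddCommMonoid M] {v : E.Vertex} (h : {e : E.Edge | E.source e = v}.Finite)
    (g : L.Left → L.Right → M) :
    ∑ e ∈ h.toFinset, g (L.edgeE e).1.1 (L.edgeE e).1.2 =
      ∑ r ∈ L.leftOut v, ∑ s ∈ L.rightOut (L.leftRange r), g r s := by
  rw [Finset.sum_sigma']
  symm
  refine Finset.sum_bij' (fun x hx => L.edgeE.symm ⟨(x.1, x.2), ?_⟩)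
    (fun e _ => ⟨(L.edgeE e).1.1, (L.edgeE e).1.2⟩) ?_ ?_ ?_ ?_ ?_
  · rw [Finset.mem_sigma, L.mem_rightOut] at hx
    exact hx.2.symm
  · intro x hx
    rw [Finset.mem_sigma, L.mem_leftOut] at hx
    simp [← L.source_edgeE, hx.1]
  · intro e he
    rw [Finset.mem_sigma, L.mem_leftOut, L.mem_rightOut, L.source_edgeE]
    exact ⟨by simpa using he, (L.edgeE e).2.symm⟩
  · intro x hx
    simp
  · intro e he
    simp
  · intro x hx
    simp

/-- Projections and partial isometries for the bipartite graph of a factorization. The projections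
for the vertices of `E` need not be orthogonal to those for the vertices of `F`. -/
structure ShiftFamily {E F : DirectedGraph.{u}} (L : ShiftLink E F) (D : Type*)
    [NonUnitalCStarAlgebra D] where
  p : E.Vertex → D
  q : F.Vertex → D
  z : L.Left → D
  w : L.Right → D
  isStarProjection_p : ∀ v, IsStarProjection (p v)
  p_mul_p : ∀ v v', v ≠ v' → p v * p v' = 0
  isStarProjection_q : ∀ k, IsStarProjection (q k)
  q_mul_q : ∀ k k', k ≠ k' → q k * q k' = 0
  star_z_mul_z : ∀ r, star (z r) * z r = q (L.leftRange r)
  star_z_mul_z_of_ne : ∀ r r', r ≠ r' → star (z r) * z r' = 0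
  star_w_mul_w : ∀ s, star (w s) * w s = p (L.rightRange s)
  star_w_mul_w_of_ne : ∀ s s', s ≠ s' → star (w s) * w s' = 0
  sum_z : ∀ v, ∑ r ∈ L.leftOut v, z r * star (z r) = p v
  sum_w : ∀ k, ∑ s ∈ L.rightOut k, w s * star (w s) = q k

/-- By the C⋆-identity it suffices that `(a q - a)* (a q - a) = 0`, and this expands to a
combination of powers of `q` that cancels. -/
theorem mul_eq_self_of_star_mul_self {D : Type*} [NonUnitalCStarAlgebra D] {a q : D}
    (h : star a * a = q) (hq : IsStarProjection q) : a * q = a := by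
  have hq1 : q * q = q := hq.1
  have hq2 : star q = q := hq.2
  have h0 : star (a * q - a) * (a * q - a) = 0 := by
    simp only [star_sub, StarMul.star_mul, hq2, sub_mul, mul_sub, mul_assoc, h]
    simp only [← mul_assoc, h, hq1, sub_self]
  exact sub_eq_zero.1 ((CStarRing.star_mul_self_eq_zero_iff _).1 h0)

namespace ShiftFamily

variable {E F : DirectedGraph.{u}} {L : ShiftLink E F} {D : Type*} [NonUnitalCStarAlgebra D]

/-- Exchange the two graphs. -/
def symm (T : ShiftFamily L D) : ShiftFamily L.symm D where
  p := T.q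
  q := T.p
  z := T.w
  w := T.z
  isStarProjection_p := T.isStarProjection_q
  p_mul_p := T.q_mul_q
  isStarProjection_q := T.isStarProjection_p
  q_mul_q := T.p_mul_p
  star_z_mul_z := T.star_w_mul_w
  star_z_mul_z_of_ne := T.star_w_mul_w_of_ne
  star_w_mul_w := T.star_z_mul_z
  star_w_mul_w_of_ne := T.star_z_mul_z_of_ne
  sum_z := T.sum_w
  sum_w := T.sum_z

variable (T : ShiftFamily L D)

theorem z_mul_q (r : L.Left) : T.z r * T.q (L.leftRange r) = T.z r :=
  mul_eq_self_of_star_mul_self (T.star_z_mul_z r) (T.isStarProjection_q _)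

theorem w_mul_p (s : L.Right) : T.w s * T.p (L.rightRange s) = T.w s :=
  T.symm.z_mul_q s

theorem p_mul_z (r : L.Left) : T.p (L.leftSource r) * T.z r = T.z r := by
  rw [← T.sum_z, Finset.sum_mul, Finset.sum_eq_single r]
  · rw [mul_assoc, T.star_z_mul_z, T.z_mul_q]
  · intro r' _ h
    rw [mul_assoc, T.star_z_mul_z_of_ne _ _ h, mul_zero]
  · exact fun h => absurd (L.mem_leftOut.2 rfl) h

theorem q_mul_w (s : L.Right) : T.q (L.rightSource s) * T.w s = T.w s :=
  T.symm.p_mul_z s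

theorem z_mul_star_z_mul_z (r : L.Left) : T.z r * star (T.z r) * T.z r = T.z r := by
  rw [mul_assoc, T.star_z_mul_z, T.z_mul_q]

theorem w_mul_star_w_mul_w (s : L.Right) : T.w s * star (T.w s) * T.w s = T.w s :=
  T.symm.z_mul_star_z_mul_z s

theorem z_mul_w_of_ne {r : L.Left} {s : L.Right} (h : L.leftRange r ≠ L.rightSource s) :
    T.z r * T.w s = 0 := by
  rw [← T.z_mul_q, ← T.q_mul_w s, mul_assoc, ← mul_assoc (T.q _), T.q_mul_q _ _ h, zero_mul,
    mul_zero]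

theorem star_zw_mul_zw {r r' : L.Left} {s s' : L.Right}
    (h' : L.leftRange r' = L.rightSource s') (hne : r ≠ r' ∨ s ≠ s') :
    star (T.z r * T.w s) * (T.z r' * T.w s') = 0 := by
  rw [StarMul.star_mul, mul_assoc, ← mul_assoc (star (T.z r))]
  by_cases hr : r = r'
  · subst hr
    rw [T.star_z_mul_z, h', T.q_mul_w, T.star_w_mul_w_of_ne _ _ (hne.resolve_left (by simp))]
  · rw [T.star_z_mul_z_of_ne _ _ hr, zero_mul, mul_zero]

theorem star_zw_mul_zw_self {r : L.Left} {s : L.Right} (h : L.leftRange r = L.rightSource s) :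
    star (T.z r * T.w s) * (T.z r * T.w s) = T.p (L.rightRange s) := by
  rw [StarMul.star_mul, mul_assoc, ← mul_assoc (star (T.z r)), T.star_z_mul_z, h, T.q_mul_w,
    T.star_w_mul_w]

/-- The Cuntz–Krieger `E`-family given by the paths of length two. -/
def left : CuntzKriegerFamily E D where
  p := T.p
  s e := T.z (L.edgeE e).1.1 * T.w (L.edgeE e).1.2
  isStarProjection_p := T.isStarProjection_p
  p_mul_p := T.p_mul_p
  isPartialIsometry_s e := by
    rw [mul_assoc, T.star_zw_mul_zw_self (L.edgeE e).2, mul_assoc, T.w_mul_p]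
  range_mul_range e f h := by
    have hne : (L.edgeE e).1.1 ≠ (L.edgeE f).1.1 ∨ (L.edgeE e).1.2 ≠ (L.edgeE f).1.2 := by
      by_contra! hc
      exact h (L.edgeE.injective (Subtype.ext (Prod.ext hc.1 hc.2)))
    rw [mul_assoc, ← mul_assoc (star _), T.star_zw_mul_zw (L.edgeE f).2 hne,
      zero_mul, mul_zero]
  star_s_mul_s e := by rw [T.star_zw_mul_zw_self (L.edgeE e).2, L.range_edgeE]
  range_le e := by
    rw [← L.source_edgeE, ← mul_assoc, ← mul_assoc, T.p_mul_z]
  sum_range v h _ := by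
    -- Inserting `q = ∑ w w*` between `z r` and its adjoint refines each range projection into those
    -- of the paths beginning with `r`.
    have key : ∀ r, T.z r * star (T.z r) = ∑ s ∈ L.rightOut (L.leftRange r),
        T.z r * T.w s * star (T.z r * T.w s) := by
      intro r
      calc T.z r * star (T.z r) = T.z r * T.q (L.leftRange r) * star (T.z r) := by
            rw [T.z_mul_q]
        _ = _ := by
            rw [← T.sum_w, Finset.mul_sum, Finset.sum_mul]
            simp only [StarMul.star_mul, mul_assoc]
    rw [← T.sum_z, Finset.sum_congr rfl fun r _ => key r, ← L.sum_edgeE h fun r s =>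
      T.z r * T.w s * star (T.z r * T.w s)]

/-! ### The bimodule generated by the linking elements. -/

/-- The linking elements: adjoints of the `w s`, and the `z r`. -/
def generators : Set D := Set.range (fun s => star (T.w s)) ∪ Set.range T.z

variable {T} {φ : GraphCStarAlgebra E →⋆ₙₐ[ℂ] D} {ψ : GraphCStarAlgebra F →⋆ₙₐ[ℂ] D}

theorem star_mem_generators_symm {m : D} (hm : m ∈ T.generators) :
    star m ∈ T.symm.generators := by
  rcases hm with ⟨s, rfl⟩ | ⟨r, rfl⟩
  · exact Or.inr ⟨s, (star_star _).symm⟩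
  · exact Or.inl ⟨r, rfl⟩

theorem z_mul_w_mem_range (hφ : T.left.IsImplementedBy φ) (r : L.Left) (s : L.Right) :
    T.z r * T.w s ∈ NonUnitalStarAlgHom.range φ := by
  by_cases h : L.leftRange r = L.rightSource s
  · have := hφ.s_mem_range (L.edgeE.symm ⟨(r, s), h⟩)
    simpa [left] using this
  · rw [T.z_mul_w_of_ne h]
    exact zero_mem _

/-- The four cases: `w* w'` is a vertex projection or zero; `z w` and `w* z*` are an edge element or
its adjoint, or zero; and `z z'* = ∑ (z w)(z' w)*` after inserting `q = ∑ w w*`. -/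
theorem generators_mul_star_mem_range (hφ : T.left.IsImplementedBy φ) {m m' : D}
    (hm : m ∈ T.generators) (hm' : m' ∈ T.generators) :
    m * star m' ∈ NonUnitalStarAlgHom.range φ := by
  rcases hm with ⟨s, rfl⟩ | ⟨r, rfl⟩ <;> rcases hm' with ⟨s', rfl⟩ | ⟨r', rfl⟩
  · simp only [star_star]
    by_cases h : s = s'
    · subst h
      rw [T.star_w_mul_w]
      exact hφ.p_mem_range _
    · rw [T.star_w_mul_w_of_ne _ _ h]
      exact zero_mem _
  · simpa using star_mem (z_mul_w_mem_range hφ r' s)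
  · simpa using z_mul_w_mem_range hφ r s'
  · rw [← T.z_mul_q, ← T.sum_w, Finset.mul_sum, Finset.sum_mul]
    refine sum_mem fun s _ => ?_
    have h := mul_mem (z_mul_w_mem_range hφ r s) (star_mem (z_mul_w_mem_range hφ r' s))
    simpa only [StarMul.star_mul, mul_assoc] using h

/-- Since `m m*` lies in the image of `C⋆(E)`, this puts `m` itself into the bimodule although the
algebra may have no unit. -/
theorem generators_mul_star_mul_self {m : D} (hm : m ∈ T.generators) : m * star m * m = m := by
  rcases hm with ⟨s, rfl⟩ | ⟨r, rfl⟩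
  · have := congrArg star (T.w_mul_star_w_mul_w s)
    simpa only [StarMul.star_mul, star_star, mul_assoc] using this
  · exact T.z_mul_star_z_mul_z r

/-- The bimodule spanned by the linking elements over the image of `C⋆(E)`. -/
noncomputable def bimodule (T : ShiftFamily L D) (φ : GraphCStarAlgebra E →⋆ₙₐ[ℂ] D) :
    Submodule ℂ D :=
  closedSpan (Set.image2 (fun a m => a * m) (NonUnitalStarAlgHom.range φ) T.generators)

theorem isClosed_bimodule : IsClosed (bimodule T φ : Set D) := isClosed_closedSpan _

theorem mul_generators_mem_bimodule {a m : D} (ha : a ∈ NonUnitalStarAlgHom.range φ)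
    (hm : m ∈ T.generators) : a * m ∈ bimodule T φ :=
  subset_closedSpan ⟨a, ha, m, hm, rfl⟩

theorem generators_mem_bimodule (hφ : T.left.IsImplementedBy φ) {m : D}
    (hm : m ∈ T.generators) : m ∈ bimodule T φ := by
  rw [← generators_mul_star_mul_self hm]
  exact mul_generators_mem_bimodule (generators_mul_star_mem_range hφ hm hm) hm

theorem mul_mem_bimodule {a x : D} (ha : a ∈ NonUnitalStarAlgHom.range φ)
    (hx : x ∈ bimodule T φ) : a * x ∈ bimodule T φ := by
  refine mul_left_mem_of_mem_closedSpan isClosed_bimodule ?_ hx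
  rintro _ ⟨a', ha', m, hm, rfl⟩
  simpa only [mul_assoc] using mul_generators_mem_bimodule (mul_mem ha ha') hm

/-- Regroup `(a n)(m* m') = (a (n m*)) m'`; the bracket `n m*` lies in the image of `C⋆(E)`. -/
theorem bimodule_mul_star_mul_mem (hφ : T.left.IsImplementedBy φ) {x m m' : D}
    (hx : x ∈ bimodule T φ) (hm : m ∈ T.generators) (hm' : m' ∈ T.generators) :
    x * (star m * m') ∈ bimodule T φ := by
  refine mul_right_mem_of_mem_closedSpan isClosed_bimodule ?_ hx
  rintro _ ⟨a, ha, n, hn, rfl⟩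
  have := mul_generators_mem_bimodule (mul_mem ha (generators_mul_star_mem_range hφ hn hm)) hm'
  simpa only [mul_assoc] using this

/-- The closed `*`-algebra of all elements that act from the right on a closed subspace, together
with their adjoints. -/
def rightStabilizer (X : Submodule ℂ D) : NonUnitalStarSubalgebra ℂ D where
  carrier := {b | ∀ x ∈ X, x * b ∈ X ∧ x * star b ∈ X}
  add_mem' ha hb x hx := by
    simpa only [star_add, mul_add] using
      ⟨X.add_mem (ha x hx).1 (hb x hx).1, X.add_mem (ha x hx).2 (hb x hx).2⟩
  zero_mem' x _ := by simp
  mul_mem' ha hb x hx := by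
    simpa only [StarMul.star_mul, ← mul_assoc] using
      ⟨(hb _ (ha x hx).1).1, (ha _ (hb x hx).2).2⟩
  smul_mem' c b hb x hx := by
    simpa only [star_smul, mul_smul_comm] using
      ⟨X.smul_mem c (hb x hx).1, X.smul_mem (star c) (hb x hx).2⟩
  star_mem' hb x hx := by
    simpa only [star_star] using (hb x hx).symm

theorem isClosed_rightStabilizer {X : Submodule ℂ D} (hX : IsClosed (X : Set D)) :
    IsClosed (rightStabilizer X : Set D) := by
  have : (rightStabilizer X : Set D) =
      ⋂ x ∈ X, {b | x * b ∈ X} ∩ {b | x * star b ∈ X} := by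
    ext b
    simp only [Set.mem_iInter, Set.mem_inter_iff, Set.mem_ofPred_eq]
    rfl
  rw [this]
  exact isClosed_biInter fun x _ => (hX.preimage (continuous_const_mul x)).inter
    (hX.preimage ((continuous_const_mul x).comp continuous_star))

/-- The right stabilizer is a closed `*`-subalgebra, so the generators of the image of `C⋆(F)`
suffice: `q = ∑ w w*` and `w z` are built from products `m* m'` of linking elements. -/
theorem bimodule_mul_mem (hφ : T.left.IsImplementedBy φ) (hψ : T.symm.left.IsImplementedBy ψ)
    {x b : D} (hx : x ∈ bimodule T φ) (hb : b ∈ NonUnitalStarAlgHom.range ψ) :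
    x * b ∈ bimodule T φ := by
  refine (hψ.range_le (rightStabilizer (bimodule T φ))
    (isClosed_rightStabilizer isClosed_bimodule) (fun k => ?_) (fun f => ?_) hb x hx).1
  · change T.q k ∈ _
    rw [← T.sum_w]
    refine sum_mem fun s _ y hy => ?_
    have h := bimodule_mul_star_mul_mem hφ hy (Or.inl ⟨s, rfl⟩) (Or.inl ⟨s, rfl⟩)
    simpa using h
  · intro y hy
    have hs : star (T.w (L.edgeF f).1.1) ∈ T.generators := Or.inl ⟨_, rfl⟩
    have hr : T.z (L.edgeF f).1.2 ∈ T.generators := Or.inr ⟨_, rfl⟩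
    have h1 := bimodule_mul_star_mul_mem hφ hy hs hr
    have h2 := bimodule_mul_star_mul_mem hφ hy hr hs
    rw [star_star] at h1
    refine ⟨h1, ?_⟩
    change y * star (T.w (L.edgeF f).1.1 * T.z (L.edgeF f).1.2) ∈ _
    rwa [StarMul.star_mul]

/-- In `(a m)* = m* a*` the element `m*` is a linking element for the exchanged family, whose
bimodule is stable under right multiplication by the image of `C⋆(E)`. Right-hand properties thus
follow from left-hand ones. -/
theorem star_mem_bimodule_symm (hφ : T.left.IsImplementedBy φ)
    (hψ : T.symm.left.IsImplementedBy ψ) {x : D} (hx : x ∈ bimodule T φ) :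
    star x ∈ bimodule T.symm ψ := by
  refine star_mem_of_mem_closedSpan isClosed_bimodule ?_ hx
  rintro _ ⟨a, ha, m, hm, rfl⟩
  rw [StarMul.star_mul]
  exact bimodule_mul_mem (T := T.symm) hψ hφ
    (generators_mem_bimodule hψ (star_mem_generators_symm hm)) (star_mem ha)

theorem bimodule_mul_star_mem_range (hφ : T.left.IsImplementedBy φ)
    (hcl : IsClosed (NonUnitalStarAlgHom.range φ : Set D)) {x y : D} (hx : x ∈ bimodule T φ)
    (hy : y ∈ bimodule T φ) : x * star y ∈ NonUnitalStarAlgHom.range φ := by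
  let N : Submodule ℂ D := (NonUnitalStarAlgHom.range φ).toSubmodule
  have hN : IsClosed (N : Set D) := hcl
  refine mul_right_mem_of_mem_closedSpan hN ?_ hx
  rintro _ ⟨a, ha, m, hm, rfl⟩
  suffices h : y * star (a * m) ∈ N by
    have h' : star (y * star (a * m)) ∈ NonUnitalStarAlgHom.range φ := star_mem h
    rwa [StarMul.star_mul, star_star] at h'
  refine mul_right_mem_of_mem_closedSpan hN ?_ hy
  rintro _ ⟨a', ha', m', hm', rfl⟩
  have h := mul_mem (mul_mem ha' (generators_mul_star_mem_range hφ hm' hm)) (star_mem ha)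
  change a' * m' * star (a * m) ∈ NonUnitalStarAlgHom.range φ
  simpa only [StarMul.star_mul, mul_assoc] using h

/-- The closed span of `X X*` is a closed `*`-subalgebra, and it contains the generators `p = ∑ z
z*` and `z w = z (w*)*`. -/
theorem range_le_closedSpan_bimodule (hφ : T.left.IsImplementedBy φ)
    (hψ : T.symm.left.IsImplementedBy ψ) (hcl : IsClosed (NonUnitalStarAlgHom.range ψ : Set D))
    {a : D} (ha : a ∈ NonUnitalStarAlgHom.range φ) :
    a ∈ closedSpan (Set.image2 (fun x y => x * star y) (bimodule T φ : Set D)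
      (bimodule T φ)) := by
  set J := closedSpan (Set.image2 (fun x y => x * star y) (bimodule T φ : Set D)
      (bimodule T φ)) with hJ
  have hJc : IsClosed (J : Set D) := isClosed_closedSpan _
  have hJm : ∀ x ∈ bimodule T φ, ∀ y ∈ bimodule T φ, x * star y ∈ J := fun x hx y hy =>
    subset_closedSpan ⟨x, hx, y, hy, rfl⟩
  let S : NonUnitalStarSubalgebra ℂ D :=
    { J with
      mul_mem' := by
        intro c d hc hd
        refine mul_right_mem_of_mem_closedSpan hJc ?_ hc
        rintro _ ⟨x, hx, y, hy, rfl⟩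
        refine mul_left_mem_of_mem_closedSpan hJc ?_ hd
        rintro _ ⟨x', hx', y', hy', rfl⟩
        -- In `x (y* x') y'*` the middle product lies in the image of `C⋆(F)`, so it is absorbed
        -- into `x`.
        have hb : star y * star (star x') ∈ NonUnitalStarAlgHom.range ψ :=
          bimodule_mul_star_mem_range hψ hcl (star_mem_bimodule_symm hφ hψ hy)
            (star_mem_bimodule_symm hφ hψ hx')
        have := hJm _ (bimodule_mul_mem hφ hψ hx hb) y' hy'
        simpa only [star_star, mul_assoc] using this
      star_mem' := by
        intro c hc
        refine star_mem_of_mem_closedSpan hJc ?_ hc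
        rintro _ ⟨x, hx, y, hy, rfl⟩
        simpa using hJm y hy x hx }
  have hz : ∀ r, T.z r ∈ bimodule T φ := fun r => generators_mem_bimodule hφ (Or.inr ⟨r, rfl⟩)
  have hw : ∀ s, star (T.w s) ∈ bimodule T φ := fun s =>
    generators_mem_bimodule hφ (Or.inl ⟨s, rfl⟩)
  refine hφ.range_le S hJc (fun v => ?_) (fun e => ?_) ha
  · change T.p v ∈ J
    rw [← T.sum_z]
    exact sum_mem fun r _ => hJm _ (hz r) _ (hz r)
  · have h := hJm _ (hz (L.edgeE e).1.1) _ (hw (L.edgeE e).1.2)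
    rwa [star_star] at h

theorem bimodule_le_closedSpan (hφ : T.left.IsImplementedBy φ) {x : D}
    (hx : x ∈ bimodule T φ) :
    x ∈ closedSpan (Set.image2 (fun a y => a * y)
      (NonUnitalStarAlgHom.range φ : Set D) (bimodule T φ)) := by
  refine closedSpan_le (isClosed_closedSpan _) ?_ hx
  rintro _ ⟨a, ha, m, hm, rfl⟩
  exact subset_closedSpan ⟨a, ha, m, generators_mem_bimodule hφ hm, rfl⟩

theorem linkedBy_bimodule (hφ : T.left.IsImplementedBy φ) (hψ : T.symm.left.IsImplementedBy ψ)
    (hφc : IsClosed (NonUnitalStarAlgHom.range φ : Set D))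
    (hψc : IsClosed (NonUnitalStarAlgHom.range ψ : Set D)) :
    LinkedBy (NonUnitalStarAlgHom.range φ) (NonUnitalStarAlgHom.range ψ) (bimodule T φ) := by
  have hstar : ∀ x ∈ bimodule T φ, star x ∈ bimodule T.symm ψ := fun x hx =>
    star_mem_bimodule_symm hφ hψ hx
  have hstar' : ∀ x ∈ bimodule T.symm ψ, star x ∈ bimodule T φ := fun x hx =>
    star_mem_bimodule_symm (T := T.symm) hψ hφ hx
  refine ⟨isClosed_bimodule, fun a ha x hx => mul_mem_bimodule ha hx,
    fun x hx b hb => bimodule_mul_mem hφ hψ hx hb,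
    fun x hx y hy => bimodule_mul_star_mem_range hφ hφc hx hy, fun x hx y hy => ?_,
    fun a ha => range_le_closedSpan_bimodule hφ hψ hψc ha, fun b hb => ?_,
    fun x hx => bimodule_le_closedSpan hφ hx, fun x hx => ?_⟩
  · simpa using bimodule_mul_star_mem_range hψ hψc (hstar x hx) (hstar y hy)
  · refine closedSpan_le (isClosed_closedSpan _) ?_
      (range_le_closedSpan_bimodule (T := T.symm) hψ hφ hφc hb)
    rintro _ ⟨x, hx, y, hy, rfl⟩
    exact subset_closedSpan ⟨star x, hstar' x hx, star y, hstar' y hy, by simp⟩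
  · rw [← star_star x]
    refine star_mem_of_mem_closedSpan (isClosed_closedSpan _) ?_
      (bimodule_le_closedSpan (T := T.symm) hψ (hstar x hx))
    rintro _ ⟨b, hb, y, hy, rfl⟩
    exact subset_closedSpan ⟨star y, hstar' y hy, star b, star_mem hb, by simp⟩

end ShiftFamily

/-! ### Extending Cuntz–Krieger families -/

/-- The image of a Cuntz–Krieger family under a homomorphism. -/
def CuntzKriegerFamily.map {E : DirectedGraph.{u}} {A B : Type*} [NonUnitalCStarAlgebra A]
    [NonUnitalCStarAlgebra B] (t : CuntzKriegerFamily E A) (φ : A →⋆ₙₐ[ℂ] B) :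
    CuntzKriegerFamily E B where
  p v := φ (t.p v)
  s e := φ (t.s e)
  isStarProjection_p v := (t.isStarProjection_p v).map φ
  p_mul_p v w h := by rw [← map_mul, t.p_mul_p v w h, map_zero]
  isPartialIsometry_s e := by
    rw [← map_star, ← map_mul, ← map_mul, t.isPartialIsometry_s]
  range_mul_range e f h := by
    rw [← map_star, ← map_star, ← map_mul, ← map_mul, ← map_mul, t.range_mul_range e f h,
      map_zero]
  star_s_mul_s e := by rw [← map_star, ← map_mul, t.star_s_mul_s]
  range_le e := by rw [← map_star, ← map_mul, ← map_mul, t.range_le]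
  sum_range v h hne := by
    rw [t.sum_range v h hne, map_sum]
    simp only [map_mul, map_star]

namespace CuntzKriegerFamily

variable {E : DirectedGraph.{u}} {D : Type*} [NonUnitalCStarAlgebra D]
  (t : CuntzKriegerFamily E D)

theorem s_mul_p (e : E.Edge) : t.s e * t.p (E.range e) = t.s e := by
  rw [← t.star_s_mul_s, ← mul_assoc, t.isPartialIsometry_s]

theorem star_s_mul_s_of_ne {e f : E.Edge} (h : e ≠ f) : star (t.s e) * t.s f = 0 := by
  have h1 : star (t.s e) = star (t.s e) * (t.s e * star (t.s e)) := by
    have := congrArg star (t.isPartialIsometry_s e)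
    simp only [StarMul.star_mul, star_star] at this
    exact this.symm
  rw [h1, ← t.isPartialIsometry_s f, mul_assoc, ← mul_assoc (t.s e * star (t.s e)),
    t.range_mul_range e f h, zero_mul, mul_zero]

end CuntzKriegerFamily

/-- The algebra `D` contains infinitely many isometries with orthogonal ranges. -/
def HasOrthogonalIsometries (D : Type*) [NonUnitalCStarAlgebra D] : Prop :=
  ∃ V : ℕ → D, (∀ n x, star (V n) * (V n * x) = x) ∧ ∀ m n, m ≠ n → star (V m) * V n = 0

namespace ShiftLink

variable {E F : DirectedGraph.{u}} (L : ShiftLink E F) {D : Type*} [NonUnitalCStarAlgebra D]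
  (t : CuntzKriegerFamily E D)

open Classical in
/-- The partial isometry of the edge composed of `r` and `s`, or zero if there is none. -/
noncomputable def path (r : L.Left) (s : L.Right) : D :=
  if h : L.leftRange r = L.rightSource s then t.s (L.edgeE.symm ⟨(r, s), h⟩) else 0

theorem path_edgeE (e : E.Edge) : L.path t (L.edgeE e).1.1 (L.edgeE e).1.2 = t.s e := by
  rw [path, dif_pos (L.edgeE e).2]
  simp

theorem path_mul_p (r : L.Left) (s : L.Right) :
    L.path t r s * t.p (L.rightRange s) = L.path t r s := by
  unfold path
  split_ifs with h
  · have := t.s_mul_p (L.edgeE.symm ⟨(r, s), h⟩)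
    simpa [← L.range_edgeE] using this
  · simp

theorem star_path_mul_path_self {r : L.Left} {s : L.Right}
    (h : L.leftRange r = L.rightSource s) :
    star (L.path t r s) * L.path t r s = t.p (L.rightRange s) := by
  rw [path, dif_pos h, t.star_s_mul_s, ← L.range_edgeE]
  simp

theorem star_path_mul_path {r r' : L.Left} {s s' : L.Right} (h : r = r' → s ≠ s') :
    star (L.path t r s) * L.path t r' s' = 0 := by
  unfold path
  split_ifs with h1 h2
  · refine t.star_s_mul_s_of_ne fun hc => ?_
    have := L.edgeE.symm.injective hc
    simp only [Subtype.mk.injEq, Prod.mk.injEq] at this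
    exact h this.1 this.2
  all_goals simp

theorem sum_path (hE : E.IsRegular) (v : E.Vertex) :
    ∑ r ∈ L.leftOut v, ∑ s ∈ L.rightOut (L.leftRange r), L.path t r s * star (L.path t r s) =
      t.p v := by
  rw [t.sum_range v (hE v).1 (hE v).2,
    ← L.sum_edgeE (hE v).1 fun r s => L.path t r s * star (L.path t r s)]
  simp only [path_edgeE]

/-- Number the edges of `L.Right` and cut the isometry of each number down to the required source
projection. -/
theorem exists_orthogonal_partialIsometries (hD : HasOrthogonalIsometries D) :
    ∃ w : L.Right → D, (∀ s, star (w s) * w s = t.p (L.rightRange s)) ∧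
      ∀ s s', s ≠ s' → star (w s) * w s' = 0 := by
  obtain ⟨V, hV, hV'⟩ := hD
  have := L.countable_right
  obtain ⟨i, hi⟩ := exists_injective_nat L.Right
  refine ⟨fun s => V (i s) * t.p (L.rightRange s), fun s => ?_, fun s s' h => ?_⟩
  · rw [StarMul.star_mul, mul_assoc, hV, (t.isStarProjection_p _).2.star_eq,
      (t.isStarProjection_p _).1.eq]
  · rw [StarMul.star_mul, mul_assoc, ← mul_assoc (star (V _)), hV' _ _ (hi.ne h), zero_mul,
      mul_zero]

/-- Every Cuntz–Krieger `E`-family in an algebra with enough room comes from a family over the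
factorization. -/
theorem exists_shiftFamily (hE : E.IsRegular) (hD : HasOrthogonalIsometries D) :
    ∃ T : ShiftFamily L D, (∀ v, T.left.p v = t.p v) ∧ ∀ e, T.left.s e = t.s e := by
  obtain ⟨w, hw, hw'⟩ := L.exists_orthogonal_partialIsometries t hD
  have hwp : ∀ s, w s * t.p (L.rightRange s) = w s := fun s =>
    mul_eq_self_of_star_mul_self (hw s) (t.isStarProjection_p _)
  have hwww : ∀ s, w s * star (w s) * (w s * star (w s)) = w s * star (w s) := fun s => by
    rw [mul_assoc, ← mul_assoc (star (w s)), hw, ← mul_assoc, hwp]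
  have hww0 : ∀ s s', s ≠ s' → w s * star (w s) * (w s' * star (w s')) = 0 := fun s s' h => by
    rw [mul_assoc, ← mul_assoc (star (w s)), hw' s s' h, zero_mul, mul_zero]
  -- This choice is forced: `z r = z r * q = ∑ (z r * w s) * star (w s)`, and `z r * w s` has to be
  -- the prescribed path element.
  let z : L.Left → D := fun r =>
    ∑ s ∈ L.rightOut (L.leftRange r), L.path t r s * star (w s)
  have hzw : ∀ r s, L.leftRange r = L.rightSource s → z r * w s = L.path t r s := by
    intro r s h
    simp only [z, Finset.sum_mul]
    rw [Finset.sum_eq_single s]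
    · rw [mul_assoc, hw, L.path_mul_p]
    · intro s' _ hs
      rw [mul_assoc, hw' _ _ hs, mul_zero]
    · exact fun hs => absurd (L.mem_rightOut.2 h.symm) hs
  refine ⟨{
    p := t.p
    q := fun k => ∑ s ∈ L.rightOut k, w s * star (w s)
    z := z
    w := w
    isStarProjection_p := t.isStarProjection_p
    p_mul_p := t.p_mul_p
    isStarProjection_q := fun k => ⟨?_, ?_⟩
    q_mul_q := fun k k' h => ?_
    star_z_mul_z := fun r => ?_
    star_z_mul_z_of_ne := fun r r' h => ?_
    star_w_mul_w := hw
    star_w_mul_w_of_ne := hw'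
    sum_z := fun v => ?_
    sum_w := fun k => rfl }, fun v => rfl, fun e => ?_⟩
  · rw [IsIdempotentElem, Finset.sum_mul]
    refine Finset.sum_congr rfl fun s hs => ?_
    rw [Finset.mul_sum, Finset.sum_eq_single s (fun s' _ h => hww0 s s' h.symm)
      (fun h => absurd hs h), hwww]
  · simp [IsSelfAdjoint, star_sum]
  · rw [Finset.sum_mul]
    refine Finset.sum_eq_zero fun s hs => ?_
    rw [Finset.mul_sum]
    refine Finset.sum_eq_zero fun s' hs' => hww0 s s' ?_
    rintro rfl
    rw [L.mem_rightOut] at hs hs'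
    exact h (hs.symm.trans hs')
  · simp only [z, star_sum, Finset.sum_mul]
    refine Finset.sum_congr rfl fun s hs => ?_
    rw [Finset.mul_sum, Finset.sum_eq_single s]
    · rw [StarMul.star_mul, star_star, mul_assoc, ← mul_assoc (star (L.path t r s)),
        L.star_path_mul_path_self t (L.mem_rightOut.1 hs).symm, ← mul_assoc, hwp]
    · intro s' _ h
      rw [StarMul.star_mul, star_star, mul_assoc, ← mul_assoc (star (L.path t r s)),
        L.star_path_mul_path t (fun _ => h.symm), zero_mul, mul_zero]
    · exact fun h => absurd hs h
  · simp only [z, star_sum, Finset.sum_mul]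
    refine Finset.sum_eq_zero fun s _ => ?_
    rw [Finset.mul_sum]
    refine Finset.sum_eq_zero fun s' _ => ?_
    rw [StarMul.star_mul, star_star, mul_assoc, ← mul_assoc (star (L.path t r s)),
      L.star_path_mul_path t (fun hr => absurd hr h), zero_mul, mul_zero]
  -- The cross terms vanish and `w* w` is absorbed by the path, so `z z*` is the sum of the range
  -- projections of the paths beginning with `r`.
  · rw [← L.sum_path t hE v]
    refine Finset.sum_congr rfl fun r _ => ?_
    simp only [z, star_sum, Finset.sum_mul]
    refine Finset.sum_congr rfl fun s hs => ?_
    rw [Finset.mul_sum, Finset.sum_eq_single s]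
    · rw [StarMul.star_mul, star_star, mul_assoc, ← mul_assoc (star (w s)), hw, ← mul_assoc,
        L.path_mul_p]
    · intro s' _ h
      rw [StarMul.star_mul, star_star, mul_assoc, ← mul_assoc (star (w s)), hw' _ _ h.symm,
        zero_mul, mul_zero]
    · exact fun h => absurd hs h
  · exact (hzw _ _ (L.edgeE e).2).trans (L.path_edgeE t e)

end ShiftLink

/-! ### Faithfulness -/

namespace ShiftFamily

variable {E F : DirectedGraph.{u}} {L : ShiftLink E F} {D D' : Type*} [NonUnitalCStarAlgebra D]
  [NonUnitalCStarAlgebra D']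

/-- The direct sum of two families. -/
def prod (T : ShiftFamily L D) (T' : ShiftFamily L D') : ShiftFamily L (D × D') where
  p v := (T.p v, T'.p v)
  q k := (T.q k, T'.q k)
  z r := (T.z r, T'.z r)
  w s := (T.w s, T'.w s)
  isStarProjection_p v := ⟨Prod.ext (T.isStarProjection_p v).1 (T'.isStarProjection_p v).1,
    Prod.ext (T.isStarProjection_p v).2 (T'.isStarProjection_p v).2⟩
  p_mul_p v v' h := Prod.ext (T.p_mul_p v v' h) (T'.p_mul_p v v' h)
  isStarProjection_q k := ⟨Prod.ext (T.isStarProjection_q k).1 (T'.isStarProjection_q k).1,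
    Prod.ext (T.isStarProjection_q k).2 (T'.isStarProjection_q k).2⟩
  q_mul_q k k' h := Prod.ext (T.q_mul_q k k' h) (T'.q_mul_q k k' h)
  star_z_mul_z r := Prod.ext (T.star_z_mul_z r) (T'.star_z_mul_z r)
  star_z_mul_z_of_ne r r' h := Prod.ext (T.star_z_mul_z_of_ne r r' h) (T'.star_z_mul_z_of_ne r r' h)
  star_w_mul_w s := Prod.ext (T.star_w_mul_w s) (T'.star_w_mul_w s)
  star_w_mul_w_of_ne s s' h := Prod.ext (T.star_w_mul_w_of_ne s s' h) (T'.star_w_mul_w_of_ne s s' h)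
  sum_z v := Prod.ext (by simpa [Prod.fst_sum] using T.sum_z v)
    (by simpa [Prod.snd_sum] using T'.sum_z v)
  sum_w k := Prod.ext (by simpa [Prod.fst_sum] using T.sum_w k)
    (by simpa [Prod.snd_sum] using T'.sum_w k)

theorem isImplementedBy_prod {T : ShiftFamily L D} {T' : ShiftFamily L D'}
    {φ : GraphCStarAlgebra E →⋆ₙₐ[ℂ] D} {φ' : GraphCStarAlgebra E →⋆ₙₐ[ℂ] D'}
    (h : T.left.IsImplementedBy φ) (h' : T'.left.IsImplementedBy φ') :
    (T.prod T').left.IsImplementedBy (φ.prod φ') :=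
  ⟨fun v => Prod.ext (h.map_p v) (h'.map_p v), fun e => Prod.ext (h.map_s e) (h'.map_s e)⟩

end ShiftFamily

/-- Fullness on the right approximates `star b` by sums of `y* y'`. This gives `X b b* = 0`, then
`b* b b* = 0`, hence `b = 0` by the C⋆-identity. -/
theorem LinkedBy.eq_zero_of_forall {D : Type*} [NonUnitalCStarAlgebra D]
    {A B : NonUnitalStarSubalgebra ℂ D} {X : Submodule ℂ D} (h : LinkedBy A B X) {b : D}
    (hb : b ∈ B) (h0 : ∀ x ∈ X, ∀ y ∈ X, x * b * star y = 0) : b = 0 := by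
  -- Vanishing is expressed as membership in the closed subspace `⊥`, so the closed-span lemmas
  -- apply.
  have hbot : IsClosed ((⊥ : Submodule ℂ D) : Set D) := by simp
  have h1 : ∀ x ∈ X, x * b * star b = 0 := by
    intro x hx
    refine mul_left_mem_of_mem_closedSpan hbot ?_ (h.right_dense _ (star_mem hb))
    rintro _ ⟨y, hy, y', hy', rfl⟩
    change x * b * (star y * y') = 0
    rw [← mul_assoc, h0 x hx y hy, zero_mul]
  have h2 : star b * (b * star b) = 0 := by
    refine mul_right_mem_of_mem_closedSpan hbot ?_ (h.right_dense _ (star_mem hb))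
    rintro _ ⟨x, hx, x', hx', rfl⟩
    change star x * x' * (b * star b) = 0
    rw [mul_assoc, ← mul_assoc x', h1 x' hx', mul_zero]
  have h3 : star (b * star b) * (b * star b) = 0 := by
    rw [StarMul.star_mul, star_star, mul_assoc, h2, mul_zero]
  exact (CStarRing.mul_star_self_eq_zero_iff b).1 ((CStarRing.star_mul_self_eq_zero_iff _).1 h3)

namespace ShiftFamily

variable {E F : DirectedGraph.{u}} {L : ShiftLink E F} {D D' : Type*} [NonUnitalCStarAlgebra D]
  [NonUnitalCStarAlgebra D']

/-- Faithfulness of the `E`-part of a family implies faithfulness of its `F`-part, because some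
family over the factorization has a faithful `F`-part. -/
theorem injective_of_injective {T : ShiftFamily L D} {T' : ShiftFamily L D'}
    {φ : GraphCStarAlgebra E →⋆ₙₐ[ℂ] D} {ψ : GraphCStarAlgebra F →⋆ₙₐ[ℂ] D}
    {φ' : GraphCStarAlgebra E →⋆ₙₐ[ℂ] D'} {ψ' : GraphCStarAlgebra F →⋆ₙₐ[ℂ] D'}
    (hφ : T.left.IsImplementedBy φ) (hψ : T.symm.left.IsImplementedBy ψ)
    (hφ' : T'.left.IsImplementedBy φ') (hψ' : T'.symm.left.IsImplementedBy ψ')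
    (hinj : Function.Injective φ) (hinj' : Function.Injective ψ') : Function.Injective ψ := by
  have hΦ : Function.Injective (φ.prod φ') := fun a b h => hinj (congrArg Prod.fst h)
  have hΨ : Function.Injective (ψ.prod ψ') := fun a b h => hinj' (congrArg Prod.snd h)
  -- Faithfulness of `φ` makes the first sum faithful and that of `ψ'` the second, so both ranges
  -- are closed.
  have hlink := linkedBy_bimodule (isImplementedBy_prod hφ hφ')
    (isImplementedBy_prod (T := T.symm) (T' := T'.symm) hψ hψ')
    (NonUnitalStarAlgHom.isClosed_range_of_injective _ hΦ)
    (NonUnitalStarAlgHom.isClosed_range_of_injective _ hΨ)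
  refine (injective_iff_map_eq_zero ψ).2 fun b hb => ?_
  have hmem : ψ.prod ψ' b ∈ NonUnitalStarAlgHom.range (ψ.prod ψ') := ⟨b, rfl⟩
  refine (injective_iff_map_eq_zero (ψ.prod ψ')).1 hΨ b (hlink.eq_zero_of_forall hmem ?_)
  intro x hx y hy
  -- The product `x b y*` is the image of some `a` in `C⋆(E)`; its first coordinate `φ a` contains
  -- the factor `ψ b = 0`.
  obtain ⟨a, ha⟩ := hlink.mul_star _ (hlink.mul_right x hx _ hmem) y hy
  have h1 : φ a = x.1 * ψ b * star y.1 := congrArg Prod.fst ha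
  rw [hb, mul_zero, zero_mul] at h1
  rw [← ha, (injective_iff_map_eq_zero φ).1 hinj a h1]
  exact map_zero _

end ShiftFamily

/-- Every Cuntz–Krieger family in `D` comes from a homomorphism. -/
def IsUniversalTarget (D : Type*) [NonUnitalCStarAlgebra D] : Prop :=
  ∀ (G : DirectedGraph.{u}) (t : CuntzKriegerFamily G D),
    ∃ φ : GraphCStarAlgebra G →⋆ₙₐ[ℂ] D, t.IsImplementedBy φ

theorem ShiftLink.exists_shiftFamily_of_hom {E F : DirectedGraph.{u}} (L : ShiftLink E F)
    (hE : E.IsRegular) {D : Type*} [NonUnitalCStarAlgebra D] (hU : IsUniversalTarget.{u} D)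
    (hV : HasOrthogonalIsometries D) (φ : GraphCStarAlgebra E →⋆ₙₐ[ℂ] D) :
    ∃ (T : ShiftFamily L D) (ψ : GraphCStarAlgebra F →⋆ₙₐ[ℂ] D),
      T.left.IsImplementedBy φ ∧ T.symm.left.IsImplementedBy ψ := by
  obtain ⟨T, hp, hs⟩ := L.exists_shiftFamily ((GraphCStarAlgebra.family E).map φ) hE hV
  obtain ⟨ψ, hψ⟩ := hU F T.symm.left
  exact ⟨T, ψ, ⟨fun v => (hp v).symm, fun e => (hs e).symm⟩, hψ⟩

/-- The comparison family is built over `L.symm` from the faithful `ψ'` and then exchanged, so that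
its `F`-part is faithful. -/
theorem ShiftLink.exists_linkedBy {E F : DirectedGraph.{u}} (L : ShiftLink E F)
    (hE : E.IsRegular) (hF : F.IsRegular) {D D' : Type*} [NonUnitalCStarAlgebra D]
    [NonUnitalCStarAlgebra D'] (hU : IsUniversalTarget.{u} D) (hV : HasOrthogonalIsometries D)
    (hU' : IsUniversalTarget.{u} D') (hV' : HasOrthogonalIsometries D')
    (φ : GraphCStarAlgebra E →⋆ₙₐ[ℂ] D) (hφ : Function.Injective φ)
    (ψ' : GraphCStarAlgebra F →⋆ₙₐ[ℂ] D') (hψ' : Function.Injective ψ') :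
    ∃ ψ : GraphCStarAlgebra F →⋆ₙₐ[ℂ] D, Function.Injective ψ ∧
      ∃ X, LinkedBy (NonUnitalStarAlgHom.range φ) (NonUnitalStarAlgHom.range ψ) X := by
  obtain ⟨T, ψ, h1, h2⟩ := L.exists_shiftFamily_of_hom hE hU hV φ
  obtain ⟨T', φ', h1', h2'⟩ := L.symm.exists_shiftFamily_of_hom hF hU' hV' ψ'
  have hψ : Function.Injective ψ :=
    ShiftFamily.injective_of_injective (T := T) (T' := T'.symm) h1 h2 h2' h1' hφ hψ'
  exact ⟨ψ, hψ, _, ShiftFamily.linkedBy_bimodule h1 h2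
    (NonUnitalStarAlgHom.isClosed_range_of_injective _ hφ)
    (NonUnitalStarAlgHom.isClosed_range_of_injective _ hψ)⟩

/-! ### Algebras of bounded families of operators -/

section BoundedFamilies

/-- A family of homomorphisms, as a homomorphism to the algebra of bounded families. -/
noncomputable def NonUnitalStarAlgHom.lpInfty {I : Type*} {A : I → Type*}
    [∀ i, NonUnitalCStarAlgebra (A i)] {C : Type*} [NonUnitalCStarAlgebra C]
    (f : ∀ i, C →⋆ₙₐ[ℂ] A i) : C →⋆ₙₐ[ℂ] lp A ∞ where
  toFun c := ⟨fun i => f i c, memℓp_infty ⟨‖c‖, by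
    rintro _ ⟨i, rfl⟩
    exact NonUnitalStarAlgHom.norm_apply_le (f i) c⟩⟩
  map_smul' a c := Subtype.ext (funext fun i => map_smul (f i) a c)
  map_zero' := Subtype.ext (funext fun i => map_zero (f i))
  map_add' c d := Subtype.ext (funext fun i => map_add (f i) c d)
  map_mul' c d := Subtype.ext (funext fun i => map_mul (f i) c d)
  map_star' c := Subtype.ext (funext fun i => map_star (f i) c)

/-- The coordinate homomorphisms of the algebra of bounded families. -/
noncomputable def lpInftyEval {I : Type*} {A : I → Type*} [∀ i, NonUnitalCStarAlgebra (A i)]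
    (i : I) : lp A ∞ →⋆ₙₐ[ℂ] A i where
  toFun x := x.1 i
  map_smul' _ _ := rfl
  map_zero' := rfl
  map_add' _ _ := rfl
  map_mul' _ _ := rfl
  map_star' _ := rfl

variable {I : Type*} (K : I → Type u) [∀ i, NormedAddCommGroup (K i)]
  [∀ i, InnerProductSpace ℂ (K i)] [∀ i, CompleteSpace (K i)]

/-- Each coordinate of the family acts on a Hilbert space in the universe over which the graph
algebra is universal. The coordinate representations are contractive and assemble to one
homomorphism. -/
theorem isUniversalTarget_lp : IsUniversalTarget.{u} (lp (fun i => K i →L[ℂ] K i) ∞) := by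
  intro G t
  refine ⟨NonUnitalStarAlgHom.lpInfty fun i =>
    GraphCStarAlgebra.rep ⟨K i, t.map (lpInftyEval i)⟩, fun v => ?_, fun e => ?_⟩
  · exact Subtype.ext (funext fun i => rfl)
  · exact Subtype.ext (funext fun i => rfl)

theorem hasOrthogonalIsometries_lp
    (h : ∀ i, ∃ V : ℕ → K i →L[ℂ] K i, (∀ n, star (V n) * V n = 1) ∧
      ∀ m n, m ≠ n → star (V m) * V n = 0) :
    HasOrthogonalIsometries (lp (fun i => K i →L[ℂ] K i) ∞) := by
  choose V hV hV' using h
  have hbound : ∀ i n, ‖V i n‖ ≤ 1 := by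
    intro i n
    have h1 : ‖V i n‖ * ‖V i n‖ ≤ 1 := by
      rw [← CStarRing.norm_star_mul_self, hV]
      exact ContinuousLinearMap.norm_id_le
    nlinarith [norm_nonneg (V i n)]
  refine ⟨fun n => ⟨fun i => V i n, memℓp_infty ⟨1, ?_⟩⟩, fun n x => ?_, fun m n hmn => ?_⟩
  · rintro _ ⟨i, rfl⟩
    exact hbound i n
  · refine Subtype.ext (funext fun i => ?_)
    change star (V i n) * (V i n * x.1 i) = x.1 i
    rw [← mul_assoc, hV, one_mul]
  · exact Subtype.ext (funext fun i => hV' i m n hmn)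

end BoundedFamilies

section Amplification

variable (H : Type u) [NormedAddCommGroup H] [InnerProductSpace ℂ H]

/-- The Hilbert space of square-summable sequences in `H`. -/
abbrev Amplification : Type u := lp (fun _ : ℕ => H) 2

/-- The inclusion of the `n`-th summand, as a linear map. -/
noncomputable def amplificationLSingle (n : ℕ) : H →ₗ[ℂ] Amplification H :=
  lp.lsingle (E := fun _ : ℕ => H) 2 n

theorem norm_amplificationLSingle (n : ℕ) (x : H) : ‖amplificationLSingle H n x‖ = ‖x‖ := by
  have h : (0 : ℝ≥0∞) < 2 := by norm_num
  exact lp.norm_single (E := fun _ : ℕ => H) h n x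

/-- The inclusion of the `n`-th summand. -/
noncomputable def amplificationSingle (n : ℕ) : H →ₗᵢ[ℂ] Amplification H where
  toLinearMap := amplificationLSingle H n
  norm_map' := norm_amplificationLSingle H n

theorem inner_amplificationSingle_of_ne {m n : ℕ} (h : m ≠ n) (x y : H) :
    inner ℂ (amplificationSingle H m x) (amplificationSingle H n y) = 0 := by
  change inner ℂ (lp.single 2 m x : Amplification H) (lp.single 2 n y) = 0
  rw [lp.inner_single_left, lp.single_apply_ne _ _ _ h, inner_zero_right]

/-- For fixed `n` the summands indexed by `Nat.pair n m` form one of infinitely many disjoint copies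
of `ℕ`. -/
theorem orthogonalFamily_amplification (n : ℕ) :
    OrthogonalFamily ℂ (fun _ : ℕ => H) fun m => amplificationSingle H (Nat.pair n m) := by
  intro i j hij x y
  refine inner_amplificationSingle_of_ne H (fun h => hij ?_) x y
  exact (Nat.pair_eq_pair.1 h).2

/-- Isometries with orthogonal ranges, from the decomposition of `ℕ` into infinitely many copies
of itself. -/
noncomputable def amplificationIsometry [CompleteSpace H] (n : ℕ) :
    Amplification H →ₗᵢ[ℂ] Amplification H :=
  (orthogonalFamily_amplification H n).linearIsometry

theorem inner_amplificationIsometry_of_ne [CompleteSpace H] {m n : ℕ} (h : m ≠ n)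
    (x y : Amplification H) :
    inner ℂ (amplificationIsometry H m x) (amplificationIsometry H n y) = 0 := by
  have h1 : ∀ (k : ℕ) (a : H),
      inner ℂ (amplificationSingle H (Nat.pair m k) a) (amplificationIsometry H n y) = 0 := by
    intro k a
    have hs := ((orthogonalFamily_amplification H n).hasSum_linearIsometry y).mapL
      (innerSL ℂ (amplificationSingle H (Nat.pair m k) a))
    refine hs.unique ?_
    convert hasSum_zero using 2 with j
    exact inner_amplificationSingle_of_ne H (fun hp => h (Nat.pair_eq_pair.1 hp).1) _ _
  rw [← inner_conj_symm]
  have hs := ((orthogonalFamily_amplification H m).hasSum_linearIsometry x).mapL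
    (innerSL ℂ (amplificationIsometry H n y))
  have h0 : inner ℂ (amplificationIsometry H n y) (amplificationIsometry H m x) = 0 := by
    refine hs.unique ?_
    convert hasSum_zero using 2 with j
    change inner ℂ (amplificationIsometry H n y) (amplificationSingle H (Nat.pair m j) (x j)) = 0
    rw [← inner_conj_symm, h1, map_zero]
  rw [h0, map_zero]

theorem LinearIsometry.adjoint_comp_eq_id {H K : Type*} [NormedAddCommGroup H]
    [InnerProductSpace ℂ H] [CompleteSpace H] [NormedAddCommGroup K] [InnerProductSpace ℂ K]
    [CompleteSpace K] (ι : H →ₗᵢ[ℂ] K) (x : H) :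
    ContinuousLinearMap.adjoint ι.toContinuousLinearMap (ι x) = x := by
  refine ext_inner_right ℂ fun y => ?_
  rw [ContinuousLinearMap.adjoint_inner_left]
  exact ι.inner_map_map x y

theorem exists_isometries_amplification [CompleteSpace H] :
    ∃ V : ℕ → Amplification H →L[ℂ] Amplification H, (∀ n, star (V n) * V n = 1) ∧
      ∀ m n, m ≠ n → star (V m) * V n = 0 := by
  refine ⟨fun n => (amplificationIsometry H n).toContinuousLinearMap, fun n => ?_,
    fun m n h => ?_⟩
  · exact ContinuousLinearMap.ext fun x => (amplificationIsometry H n).adjoint_comp_eq_id x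
  · refine ContinuousLinearMap.ext fun x => ext_inner_right ℂ fun y => ?_
    change inner ℂ (ContinuousLinearMap.adjoint
      (amplificationIsometry H m).toContinuousLinearMap (amplificationIsometry H n x)) y =
        inner ℂ (0 : Amplification H) y
    rw [ContinuousLinearMap.adjoint_inner_left, inner_zero_left]
    exact inner_amplificationIsometry_of_ne H h.symm x y

end Amplification

/-! ### The amplified universal representation. -/

/-- Conjugation by an isometry. -/
noncomputable def LinearIsometry.conjHom {H K : Type*} [NormedAddCommGroup H]
    [InnerProductSpace ℂ H] [CompleteSpace H] [NormedAddCommGroup K] [InnerProductSpace ℂ K]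
    [CompleteSpace K] (ι : H →ₗᵢ[ℂ] K) : (H →L[ℂ] H) →⋆ₙₐ[ℂ] (K →L[ℂ] K) where
  toFun T := ι.toContinuousLinearMap ∘L T ∘L ContinuousLinearMap.adjoint ι.toContinuousLinearMap
  map_smul' c T := by ext; simp
  map_zero' := by ext; simp
  map_add' S T := by ext; simp
  map_mul' S T := by
    ext x
    simp [LinearIsometry.adjoint_comp_eq_id]
  map_star' T := by
    simp [ContinuousLinearMap.star_eq_adjoint, ContinuousLinearMap.adjoint_comp,
      ContinuousLinearMap.comp_assoc]

theorem LinearIsometry.conjHom_injective {H K : Type*} [NormedAddCommGroup H]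
    [InnerProductSpace ℂ H] [CompleteSpace H] [NormedAddCommGroup K] [InnerProductSpace ℂ K]
    [CompleteSpace K] (ι : H →ₗᵢ[ℂ] K) : Function.Injective ι.conjHom := by
  intro S T h
  ext x
  have := congrArg (fun R : K →L[ℂ] K => R (ι x)) h
  simpa [conjHom, LinearIsometry.adjoint_comp_eq_id] using this

/-- The bounded families of operators on the amplified spaces of all Cuntz–Krieger families. -/
def AmplifiedOperatorAlgebra (E : DirectedGraph.{u}) : Type (u + 1) :=
  lp (fun π : CuntzKriegerRepresentation E =>
    Amplification π.Space →L[ℂ] Amplification π.Space) ∞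

noncomputable instance AmplifiedOperatorAlgebra.instNonUnitalCStarAlgebra
    (E : DirectedGraph.{u}) : NonUnitalCStarAlgebra (AmplifiedOperatorAlgebra E) :=
  inferInstanceAs (NonUnitalCStarAlgebra (lp (fun π : CuntzKriegerRepresentation E =>
    Amplification π.Space →L[ℂ] Amplification π.Space) ∞))

/-- The amplified universal representation. -/
noncomputable def GraphCStarAlgebra.amplifiedHom (E : DirectedGraph.{u}) :
    GraphCStarAlgebra E →⋆ₙₐ[ℂ] AmplifiedOperatorAlgebra E :=
  NonUnitalStarAlgHom.lpInfty fun π => (amplificationSingle π.Space 0).conjHom.comp (rep π)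

theorem GraphCStarAlgebra.amplifiedHom_injective (E : DirectedGraph.{u}) :
    Function.Injective (amplifiedHom E) := fun _ _ h =>
  ext_rep fun π => (amplificationSingle π.Space 0).conjHom_injective
    (congrFun (congrArg Subtype.val h) π)

theorem isUniversalTarget_amplified (E : DirectedGraph.{u}) :
    IsUniversalTarget.{u} (AmplifiedOperatorAlgebra E) :=
  isUniversalTarget_lp _

theorem hasOrthogonalIsometries_amplified (E : DirectedGraph.{u}) :
    HasOrthogonalIsometries (AmplifiedOperatorAlgebra E) :=
  hasOrthogonalIsometries_lp _ fun π => exists_isometries_amplification π.Space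

/-! ### The imprimitivity bimodule -/

/-- Positivity is reflected by a faithful homomorphism. Compressing `c` by its negative part gives
`-(c⁻)³`, whose image is both nonnegative and nonpositive; hence `c⁻ = 0`. -/
theorem NonUnitalStarAlgHom.exists_eq_star_mul_self_of_injective {A D : Type*}
    [NonUnitalCStarAlgebra A] [NonUnitalCStarAlgebra D] (φ : A →⋆ₙₐ[ℂ] D)
    (hφ : Function.Injective φ) {c : A} {d : D} (h : φ c = star d * d) :
    ∃ a, c = star a * a := by
  let _ := CStarAlgebra.spectralOrder A
  let _ := CStarAlgebra.spectralOrderedRing A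
  let _ := CStarAlgebra.spectralOrder D
  let _ := CStarAlgebra.spectralOrderedRing D
  rw [← CStarAlgebra.nonneg_iff_eq_star_mul_self]
  have hc : IsSelfAdjoint c := hφ (by rw [map_star, h]; simp)
  have hn0 : 0 ≤ c⁻ := CFC.negPart_nonneg c
  have hn : star c⁻ = c⁻ := (IsSelfAdjoint.of_nonneg hn0).star_eq
  -- Writing `c⁻ = m* m` makes the cube `(c⁻)³ = (m c⁻)* (m c⁻)` visibly positive.
  obtain ⟨m, hm⟩ := CStarAlgebra.nonneg_iff_eq_star_mul_self.1 hn0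
  have hcube : c⁻ * c * c⁻ = -(star (m * c⁻) * (m * c⁻)) := by
    nth_rw 2 [← CFC.posPart_sub_negPart c hc]
    rw [mul_sub, sub_mul, CFC.negPart_mul_posPart, zero_mul, zero_sub, StarMul.star_mul, hn]
    nth_rw 2 [hm]
    simp only [mul_assoc]
  have h1 : 0 ≤ -φ (star (m * c⁻) * (m * c⁻)) := by
    have hφn : star (φ c⁻) = φ c⁻ := by rw [← map_star, hn]
    rw [← map_neg, ← hcube, map_mul, map_mul, h,
      show φ c⁻ * (star d * d) * φ c⁻ = star (d * φ c⁻) * (d * φ c⁻) by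
        simp only [StarMul.star_mul, hφn, mul_assoc]]
    exact star_mul_self_nonneg _
  have h2 : 0 ≤ φ (star (m * c⁻) * (m * c⁻)) := by
    rw [map_mul, map_star]
    exact star_mul_self_nonneg _
  have h3 : star (m * c⁻) * (m * c⁻) = 0 :=
    (injective_iff_map_eq_zero φ).1 hφ _ (le_antisymm (neg_nonneg.1 h1) h2)
  have h4 : m * c⁻ = 0 := (CStarRing.star_mul_self_eq_zero_iff _).1 h3
  have h5 : star c⁻ * c⁻ = 0 := by
    rw [hn]
    nth_rw 1 [hm]
    rw [mul_assoc, h4, mul_zero]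
  exact (CFC.negPart_eq_zero_iff c hc).1 ((CStarRing.star_mul_self_eq_zero_iff _).1 h5)

theorem NonUnitalStarAlgHom.dense_span_of_injective {A D : Type*}
    [NonUnitalCStarAlgebra A] [NonUnitalCStarAlgebra D] (φ : A →⋆ₙₐ[ℂ] D)
    (hφ : Function.Injective φ) {S : Set A} {S' : Set D} (hS : φ '' S = S')
    (h : ∀ a, φ a ∈ closedSpan S') : Dense (Submodule.span ℂ S : Set A) := by
  intro a
  have hind := (NonUnitalStarAlgHom.isometry φ hφ).isUniformInducing.isInducing
  rw [hind.closure_eq_preimage_closure_image, Set.mem_preimage]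
  have hspan : φ '' (Submodule.span ℂ S : Set A) = Submodule.span ℂ S' := by
    rw [← hS]
    exact congrArg (fun N : Submodule ℂ D => (N : Set D))
      (Submodule.map_span (φ : A →ₗ[ℂ] D) S)
  rw [hspan]
  exact h a

/-- The inner products are the preimages of `x y*` and `x* y`. Algebraic axioms are checked in `D`,
where they reduce to associativity and linearity; the norm axioms are the C⋆-identity, as `φ` and
`ψ` are isometric. -/
theorem LinkedBy.nonempty_imprimitivityBimodule {A B D : Type*} [NonUnitalCStarAlgebra A]
    [NonUnitalCStarAlgebra B] [NonUnitalCStarAlgebra D] {φ : A →⋆ₙₐ[ℂ] D} {ψ : B →⋆ₙₐ[ℂ] D}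
    (hφ : Function.Injective φ) (hψ : Function.Injective ψ) {X : Submodule ℂ D}
    (h : LinkedBy (NonUnitalStarAlgHom.range φ) (NonUnitalStarAlgHom.range ψ) X)
    [CompleteSpace X] : Nonempty (ImprimitivityBimodule A B X) := by
  have hl : ∀ x y : X, ∃ a, φ a = x * star (y : D) := fun x y => h.mul_star x x.2 y y.2
  have hr : ∀ x y : X, ∃ b, ψ b = star (x : D) * y := fun x y => h.star_mul x x.2 y y.2
  choose li hli using hl
  choose ri hri using hr
  refine ⟨{
    lact := LinearMap.mk₂ ℂ (fun a x => ⟨φ a * x, h.mul_left _ ⟨a, rfl⟩ x x.2⟩) ?_ ?_ ?_ ?_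
    ract := LinearMap.mk₂ ℂ (fun b x => ⟨x * ψ b, h.mul_right x x.2 _ ⟨b, rfl⟩⟩) ?_ ?_ ?_ ?_
    linner := LinearMap.mk₂'ₛₗ (RingHom.id ℂ) (starRingEnd ℂ) li ?_ ?_ ?_ ?_
    rinner := LinearMap.mk₂'ₛₗ (starRingEnd ℂ) (RingHom.id ℂ) ri ?_ ?_ ?_ ?_
    lact_mul := fun a a' x => Subtype.ext ?_
    ract_mul := fun b b' x => Subtype.ext ?_
    lact_ract := fun a b x => Subtype.ext ?_
    linner_lact := fun a x y => hφ ?_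
    rinner_ract := fun b x y => hψ ?_
    star_linner := fun x y => hφ ?_
    star_rinner := fun x y => hψ ?_
    linner_self_nonneg := fun x =>
      φ.exists_eq_star_mul_self_of_injective hφ (d := star (x : D)) ?_
    rinner_self_nonneg := fun x => ψ.exists_eq_star_mul_self_of_injective hψ (d := x) ?_
    norm_linner_self := fun x => ?_
    norm_rinner_self := fun x => ?_
    rinner_lact := fun a x y => hψ ?_
    linner_ract := fun b x y => hφ ?_
    lact_linner := fun x y z => Subtype.ext ?_
    dense_linner := ?_
    dense_rinner := ?_ }⟩
  · exact fun a a' x => Subtype.ext (by simp [add_mul])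
  · exact fun c a x => Subtype.ext (by simp [smul_mul_assoc])
  · exact fun a x y => Subtype.ext (by simp [mul_add])
  · exact fun c a x => Subtype.ext (by simp [mul_smul_comm])
  · exact fun b b' x => Subtype.ext (by simp [mul_add])
  · exact fun c b x => Subtype.ext (by simp [mul_smul_comm])
  · exact fun b x y => Subtype.ext (by simp [add_mul])
  · exact fun c b x => Subtype.ext (by simp [smul_mul_assoc])
  · exact fun x x' y => hφ (by simp [hli, add_mul])
  · exact fun c x y => hφ (by simp [hli, smul_mul_assoc])
  · exact fun x y y' => hφ (by simp [hli, mul_add])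
  · exact fun c x y => hφ (by simp [hli, mul_smul_comm])
  · exact fun x x' y => hψ (by simp [hri, add_mul])
  · exact fun c x y => hψ (by simp [hri, smul_mul_assoc])
  · exact fun x y y' => hψ (by simp [hri, mul_add])
  · exact fun c x y => hψ (by simp [hri, mul_smul_comm])
  · simp [mul_assoc]
  · simp [mul_assoc]
  · simp [mul_assoc]
  · simp [hli, mul_assoc]
  · simp [hri, mul_assoc]
  · simp [hli, map_star]
  · simp [hri, map_star]
  · simp [hli]
  · simp [hri]
  · rw [← NonUnitalStarAlgHom.norm_map φ hφ]
    simp only [LinearMap.mk₂'ₛₗ_apply, hli, CStarRing.norm_self_mul_star]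
    exact (sq _).symm
  · rw [← NonUnitalStarAlgHom.norm_map ψ hψ]
    simp only [LinearMap.mk₂'ₛₗ_apply, hri, CStarRing.norm_star_mul_self]
    exact (sq _).symm
  · simp [hri, mul_assoc, map_star]
  · simp [hli, mul_assoc, map_star]
  · simp [hri, hli, mul_assoc]
  · refine φ.dense_span_of_injective hφ ?_ fun a => h.left_dense _ ⟨a, rfl⟩
    ext d
    constructor
    · rintro ⟨_, ⟨x, y, rfl⟩, rfl⟩
      exact ⟨x, x.2, y, y.2, (hli x y).symm⟩
    · rintro ⟨x, hx, y, hy, rfl⟩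
      exact ⟨_, ⟨⟨x, hx⟩, ⟨y, hy⟩, rfl⟩, hli _ _⟩
  · refine ψ.dense_span_of_injective hψ ?_ fun b => h.right_dense _ ⟨b, rfl⟩
    ext d
    constructor
    · rintro ⟨_, ⟨x, y, rfl⟩, rfl⟩
      exact ⟨x, x.2, y, y.2, (hri x y).symm⟩
    · rintro ⟨x, hx, y, hy, rfl⟩
      exact ⟨_, ⟨⟨x, hx⟩, ⟨y, hy⟩, rfl⟩, hri _ _⟩

theorem LinkedBy.moritaEquivalent {A B D : Type u} [NonUnitalCStarAlgebra A]
    [NonUnitalCStarAlgebra B] [NonUnitalCStarAlgebra D] {φ : A →⋆ₙₐ[ℂ] D} {ψ : B →⋆ₙₐ[ℂ] D}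
    (hφ : Function.Injective φ) (hψ : Function.Injective ψ) {X : Submodule ℂ D}
    (h : LinkedBy (NonUnitalStarAlgHom.range φ) (NonUnitalStarAlgHom.range ψ) X) :
    MoritaEquivalent A B := by
  have hc : CompleteSpace X := h.isClosed.completeSpace_coe
  exact ⟨X, inferInstance, inferInstance, hc, h.nonempty_imprimitivityBimodule hφ hψ⟩

/-! ### Strong shift equivalence -/

/-- Within every sufficiently large C⋆-algebra `D`, each faithful copy of `C⋆(E)` is linked to some
faithful copy of `C⋆(F)`. -/
def FaithfullyLinked (E F : DirectedGraph.{u}) : Prop :=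
  ∀ (D : Type (u + 1)) [NonUnitalCStarAlgebra D], IsUniversalTarget.{u} D →
    HasOrthogonalIsometries D → ∀ φ : GraphCStarAlgebra E →⋆ₙₐ[ℂ] D, Function.Injective φ →
    ∃ ψ : GraphCStarAlgebra F →⋆ₙₐ[ℂ] D, Function.Injective ψ ∧
      ∃ X, LinkedBy (NonUnitalStarAlgHom.range φ) (NonUnitalStarAlgHom.range ψ) X

/-- Quantifying over every faithful copy in `D` is what permits composition: the copy of `C⋆(F)`
produced by the first link is the input of the second. -/
theorem FaithfullyLinked.trans {E F G : DirectedGraph.{u}} (h : FaithfullyLinked E F)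
    (h' : FaithfullyLinked F G) : FaithfullyLinked E G := by
  intro D _ hU hV φ hφ
  obtain ⟨ψ, hψ, X, hX⟩ := h D hU hV φ hφ
  obtain ⟨χ, hχ, Y, hY⟩ := h' D hU hV ψ hψ
  exact ⟨χ, hχ, _, hX.trans (NonUnitalStarAlgHom.isClosed_range_of_injective _ hφ)
    (NonUnitalStarAlgHom.isClosed_range_of_injective _ hχ) hY⟩

theorem FaithfullyLinked.of_matrixProduct {E F : DirectedGraph.{u}} (hE : E.IsRegular)
    (hF : F.IsRegular) {R : Matrix E.Vertex F.Vertex ℕ} {S : Matrix F.Vertex E.Vertex ℕ}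
    (hRS : IsMatrixProduct R S E.vertexMatrix) (hSR : IsMatrixProduct S R F.vertexMatrix) :
    FaithfullyLinked E F := by
  obtain ⟨L⟩ := nonempty_shiftLink hE hF hRS hSR
  intro D _ hU hV φ hφ
  exact L.exists_linkedBy hE hF hU hV (isUniversalTarget_amplified F)
    (hasOrthogonalIsometries_amplified F) φ hφ _ (GraphCStarAlgebra.amplifiedHom_injective F)

theorem FaithfullyLinked.moritaEquivalent {E F : DirectedGraph.{u}} (h : FaithfullyLinked E F) :
    MoritaEquivalent (GraphCStarAlgebra E) (GraphCStarAlgebra F) := by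
  obtain ⟨ψ, hψ, X, hX⟩ := h (AmplifiedOperatorAlgebra E) (isUniversalTarget_amplified E)
    (hasOrthogonalIsometries_amplified E) (GraphCStarAlgebra.amplifiedHom E)
    (GraphCStarAlgebra.amplifiedHom_injective E)
  exact hX.moritaEquivalent (GraphCStarAlgebra.amplifiedHom_injective E) hψ

theorem FaithfullyLinked.of_elementary {A B : RegularSquareMatrix.{u}}
    (h : ElementaryStrongShiftEquivalent A B) : FaithfullyLinked A.graph B.graph := by
  obtain ⟨R, S, hRS, hSR⟩ := h
  refine of_matrixProduct A.graph_isRegular B.graph_isRegular (R := R) (S := S) ?_ ?_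
  · rw [A.graph_vertexMatrix]
    exact hRS
  · rw [B.graph_vertexMatrix]
    exact hSR

/-- The factorizations `A = A·1` and `A = 1·A` link a graph to the standard graph of its vertex
matrix, which attaches the given graphs to the ends of a chain of matrices. -/
theorem FaithfullyLinked.of_vertexMatrix_eq {E : DirectedGraph.{u}} (hE : E.IsRegular) :
    FaithfullyLinked E (E.regularVertexMatrix hE).graph ∧
      FaithfullyLinked (E.regularVertexMatrix hE).graph E := by
  classical
  have h1 : IsMatrixProduct (1 : Matrix E.Vertex E.Vertex ℕ) E.vertexMatrix E.vertexMatrix :=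
    isMatrixProduct_one_left _
  have h2 : IsMatrixProduct E.vertexMatrix (1 : Matrix E.Vertex E.Vertex ℕ) E.vertexMatrix :=
    isMatrixProduct_one_right _
  have h3 := (E.regularVertexMatrix hE).graph_vertexMatrix
  have h4 := (E.regularVertexMatrix hE).graph_isRegular
  constructor
  · refine of_matrixProduct hE h4 (R := E.vertexMatrix)
      (S := (1 : Matrix E.Vertex E.Vertex ℕ)) h2 ?_
    rw [h3]
    exact h1
  · refine of_matrixProduct h4 hE (R := E.vertexMatrix)
      (S := (1 : Matrix E.Vertex E.Vertex ℕ)) ?_ h1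
    rw [h3]
    exact h2

theorem theorem2p3 (E F : DirectedGraph.{u}) (hE : E.IsRegular) (hF : F.IsRegular)
    (h : StrongShiftEquivalent (E.regularVertexMatrix hE) (F.regularVertexMatrix hF)) :
    MoritaEquivalent (GraphCStarAlgebra E) (GraphCStarAlgebra F) := by
  have key : ∀ A, StrongShiftEquivalent (E.regularVertexMatrix hE) A →
      FaithfullyLinked E A.graph := by
    intro A hA
    induction hA with
    | refl => exact (FaithfullyLinked.of_vertexMatrix_eq hE).1
    | tail _ hstep ih => exact ih.trans (FaithfullyLinked.of_elementary hstep)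
  exact ((key _ h).trans (FaithfullyLinked.of_vertexMatrix_eq hF).2).moritaEquivalent
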